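/- Graph diagrams are non-empty planar diagrams of four-valent rigid vertex graphs embedded in three-space (closed components without vertices are allowed, so link diagrams are included). For variables $A,B,a$ the Kauffman–Vogel polynomial $[\,\cdot\,]$ is the regular isotopy invariant of such diagrams determined by: $[G_\times]=A[G_A]+B[G_B]+[G_\bullet]$, where $G_A,G_B$ are obtained from $G_\times$ by the two smoothings of a crossing and $G_\bullet$ by replacing the crossing by a vertex, the $A$-smoothing of a crossing being the one that respects those orientations of its two strands which make the crossing positive; adding a positive (negative) curl to an edge multiplies $[\,\cdot\,]$ by $a$ (by $a^{-1}$); and $[\,\cdot\,]=1$ on the circle without crossings. A mark at a crossing is a choice of one of the two pairs of opposite regions at the crossing. A partition of a diagram $G$ is a choice of a mark at every crossing such that there is a collection of pairwise disjoint simple closed curves in the plane that meet $G$ only at its crossings and pass through every crossing of $G$, exactly once each, from one region of the marked pair to the other. (If there are no crossings, the empty choice is a partition.) $G$ is separable if it has a partition. Proposition. For $B=A^{-1}$ and $a=A$, with $A$ an indeterminate, the polynomial $[\,\cdot\,]$ exists and is uniquely determined by the above conditions (with values in $\mathbb{Q}(A)$); every polynomial $[\,\cdot\,]$ in variables $A,B,a$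 specialises to it; and for every graph diagram $G$, $[G]=0$ if and only if $G$ is not separable. -/

import Mathlib

/-!
Diagrams of four-valent rigid vertex graphs are drawn in the plane in general position with respect
to the height function and are read from bottom to top.  A diagram is then a list of elementary
slices.  A slice at position `i` has `i` vertical strands to its left; the strands of a horizontal
line are numbered from the left, starting with `0`.
-/

namespace KauffmanVogel

/-- The points of a diagram where four ends of edges meet, the ends pointing to `SW`, `SE`, `NW`
and `NE`: the crossing whose `SW`--`NE` strand is the upper one, the crossing whose `SW`--`NE`
strand is the lower one, and the rigid vertices of the graph. -/
inductive Node
  | overCross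
  | underCross
  | vertex
  deriving DecidableEq

/-- The same point of the diagram after a rotation of the plane by a quarter turn. -/
def Node.turn : Node → Node
  | .overCross => .underCross
  | .underCross => .overCross
  | .vertex => .vertex

/-- Elementary pieces: a local minimum `∪`, a local maximum `∩`, a crossing or a vertex. -/
inductive Piece
  | cup
  | cap
  | node (x : Node)
  deriving DecidableEq

/-- Number of strands at the bottom of a piece. -/
def Piece.dom : Piece → ℕ
  | .cup => 0
  | .cap => 2
  | .node _ => 2

/-- Number of strands at the top of a piece. -/
def Piece.cod : Piece → ℕ
  | .cup => 2
  | .cap => 0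
  | .node _ => 2

/-- An elementary slice: one piece, with `pos` vertical strands to its left (and any number of
vertical strands to its right). -/
structure Slice where
  piece : Piece
  pos : ℕ
  deriving DecidableEq

/-- A minimum creating the strands `i` and `i + 1`. -/
abbrev cup (i : ℕ) : Slice := ⟨.cup, i⟩

/-- A maximum joining the strands `i` and `i + 1`. -/
abbrev cap (i : ℕ) : Slice := ⟨.cap, i⟩

/-- A crossing or vertex involving the strands `i` and `i + 1`. -/
abbrev node (x : Node) (i : ℕ) : Slice := ⟨.node x, i⟩

/-- The crossing of the strands `i` and `i + 1` with the `SW`--`NE` strand on top. -/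
abbrev overCross (i : ℕ) : Slice := node .overCross i

/-- The crossing of the strands `i` and `i + 1` with the `SW`--`NE` strand below. -/
abbrev underCross (i : ℕ) : Slice := node .underCross i

/-- A vertex of the graph on the strands `i` and `i + 1`. -/
abbrev vertex (i : ℕ) : Slice := node .vertex i

/-- `IsTangle n w m`: the slices of `w` can be stacked from bottom to top, starting with `n`
strands and ending with `m` strands. -/
inductive IsTangle : ℕ → List Slice → ℕ → Prop
  | nil (n : ℕ) : IsTangle n [] n
  | cons (p : Piece) (l r m : ℕ) (w : List Slice) :
      IsTangle (l + p.cod + r) w m → IsTangle (l + p.dom + r) (⟨p, l⟩ :: w) m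

/-- A (non-empty) graph diagram. -/
structure GraphDiagram where
  word : List Slice
  closed : IsTangle 0 word 0
  nonempty : word ≠ []

/-- The diagram of the unknot without crossings. -/
def unknot : GraphDiagram where
  word := [cup 0, cap 0]
  closed := .cons .cup 0 0 0 _ (.cons .cap 0 0 0 _ (.nil 0))
  nonempty := by simp

/-- The local moves which generate regular isotopy of diagrams of rigid vertex graphs.
The first five generate isotopy of diagrams in the plane: distant pieces move past each other,
zigzags are straightened, a crossing or vertex turns around a minimum or a maximum.  The others are
the Reidemeister moves for four-valent rigid vertex graphs, except the first one. -/
inductive Move : List Slice → List Slice → Prop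
  | exchange (p q : Piece) (i k : ℕ) :
      Move [⟨p, i⟩, ⟨q, i + p.cod + k⟩] [⟨q, i + p.dom + k⟩, ⟨p, i⟩]
  | zigzag (i : ℕ) : Move [cup i, cap (i + 1)] []
  | zigzag' (i : ℕ) : Move [cup (i + 1), cap i] []
  | turn_cup (x : Node) (i : ℕ) : Move [cup i, node x (i + 1)] [cup (i + 1), node x.turn i]
  | turn_cap (x : Node) (i : ℕ) : Move [node x (i + 1), cap i] [node x.turn i, cap (i + 1)]
  | reidemeister_two (i : ℕ) : Move [overCross i, underCross i] []
  | reidemeister_two' (i : ℕ) : Move [underCross i, overCross i] []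
  | reidemeister_three (i : ℕ) :
      Move [overCross i, overCross (i + 1), overCross i] [overCross (i + 1), overCross i, overCross (i + 1)]
  | strand_over_vertex (i : ℕ) :
      Move [overCross i, overCross (i + 1), vertex i] [vertex (i + 1), overCross i, overCross (i + 1)]
  | strand_under_vertex (i : ℕ) :
      Move [underCross i, underCross (i + 1), vertex i] [vertex (i + 1), underCross i, underCross (i + 1)]
  | flip_vertex (i : ℕ) : Move [overCross i, vertex i] [vertex i, overCross i]

/-- `P` is the Kauffman--Vogel polynomial with variables `A`, `B`, `a`: an invariant of regular
isotopy with the skein relation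
`[crossing] = A [smoothing] + B [other smoothing] + [vertex]`, whose value is multiplied by `a` or
`a⁻¹` when a positive or negative curl is added to an edge, and which is `1` on the unknot.
For `overCross` the `A`-smoothing consists of two vertical arcs and the `B`-smoothing is `∩` below `∪`;
`underCross` is `overCross` after a quarter turn, which exchanges the two smoothings. -/
structure IsKauffmanVogel {R : Type*} [CommRing R] (A B : R) (a : Rˣ)
    (P : GraphDiagram → R) : Prop where
  regular_isotopy : ∀ (G H : GraphDiagram) (u v s t : List Slice), Move s t →
    G.word = u ++ s ++ v → H.word = u ++ t ++ v → P G = P H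
  skein_over : ∀ (X V H W : GraphDiagram) (u v : List Slice) (i : ℕ),
    X.word = u ++ [overCross i] ++ v → V.word = u ++ v → H.word = u ++ [cap i, cup i] ++ v →
    W.word = u ++ [vertex i] ++ v → P X = A * P V + B * P H + P W
  skein_under : ∀ (X V H W : GraphDiagram) (u v : List Slice) (i : ℕ),
    X.word = u ++ [underCross i] ++ v → V.word = u ++ v → H.word = u ++ [cap i, cup i] ++ v →
    W.word = u ++ [vertex i] ++ v → P X = A * P H + B * P V + P W
  curl_pos : ∀ (T S : GraphDiagram) (u v : List Slice) (i : ℕ),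
    (T.word = u ++ [cup (i + 1), overCross i, cap (i + 1)] ++ v ∨
      T.word = u ++ [cup i, overCross (i + 1), cap i] ++ v) →
    S.word = u ++ v → P T = (a : R) * P S
  curl_neg : ∀ (T S : GraphDiagram) (u v : List Slice) (i : ℕ),
    (T.word = u ++ [cup (i + 1), underCross i, cap (i + 1)] ++ v ∨
      T.word = u ++ [cup i, underCross (i + 1), cap i] ++ v) →
    S.word = u ++ v → P T = ((a⁻¹ : Rˣ) : R) * P S
  unknot_eq_one : P unknot = 1

/-- The strands met by a horizontal line: of the diagram itself, or of a separating curve. -/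
inductive Strand
  | edge
  | curve
  deriving DecidableEq

/-- The two ways in which a separating curve can pass through a crossing: from the southern to the
northern region at the crossing, or from the western to the eastern one. -/
inductive Mark
  | vertical
  | horizontal
  deriving DecidableEq

open Strand in
/-- `IsSeparated s w M t`: the diagram piece `w`, read from bottom to top, can be drawn together
with pairwise disjoint simple curves that meet it only at its crossings, each crossing being passed
exactly once and in the way prescribed by the list of marks `M` (one mark for each crossing, from
bottom to top).  Here `s` and `t` are the strands of `w` and of the curves, from left to right, on
the bottom and top lines.  Between two slices of `w` the curves may have minima and maxima of their
own (`birth`, `death`).  A curve through a crossing with horizontal mark is drawn with both its ends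
turned upwards. -/
inductive IsSeparated :
    List Strand → List Slice → List Mark → List Strand → Prop
  | nil (s : List Strand) : IsSeparated s [] [] s
  | birth (x y t : List Strand) (w : List Slice) (M : List Mark) :
      IsSeparated (x ++ [curve, curve] ++ y) w M t → IsSeparated (x ++ y) w M t
  | death (x y t : List Strand) (w : List Slice) (M : List Mark) :
      IsSeparated (x ++ y) w M t → IsSeparated (x ++ [curve, curve] ++ y) w M t
  | cup (x y t : List Strand) (w : List Slice) (M : List Mark) :
      IsSeparated (x ++ [edge, edge] ++ y) w M t →
      IsSeparated (x ++ y) (cup (x.count edge) :: w) M t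
  | cap (x y t : List Strand) (w : List Slice) (M : List Mark) :
      IsSeparated (x ++ y) w M t →
      IsSeparated (x ++ [edge, edge] ++ y) (cap (x.count edge) :: w) M t
  | vertex (x y t : List Strand) (w : List Slice) (M : List Mark) :
      IsSeparated (x ++ [edge, edge] ++ y) w M t →
      IsSeparated (x ++ [edge, edge] ++ y) (vertex (x.count edge) :: w) M t
  | vertical (c : Node) (hc : c ≠ .vertex) (x y t : List Strand) (w : List Slice)
      (M : List Mark) :
      IsSeparated (x ++ [edge, curve, edge] ++ y) w M t →
      IsSeparated (x ++ [edge, curve, edge] ++ y) (node c (x.count edge) :: w)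
        (.vertical :: M) t
  | horizontal (c : Node) (hc : c ≠ .vertex) (x y t : List Strand) (w : List Slice)
      (M : List Mark) :
      IsSeparated (x ++ [curve, edge, edge, curve] ++ y) w M t →
      IsSeparated (x ++ [edge, edge] ++ y) (node c (x.count edge) :: w)
        (.horizontal :: M) t

/-- A choice of marks at the crossings is a partition if there are disjoint closed separating curves
that pass through all crossings in agreement with the marks. -/
def GraphDiagram.IsPartition (G : GraphDiagram) (M : List Mark) : Prop :=
  IsSeparated [] G.word M []

/-- A diagram is separable if it has a partition. -/
def GraphDiagram.Separable (G : GraphDiagram) : Prop :=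
  ∃ M : List Mark, G.IsPartition M

end KauffmanVogel

namespace KauffmanVogel

/-! ### Tangles -/

/-! Existence comes from a state sum with two colours. Both strands change colour at a crossing,
with weight `A` or `A⁻¹`; the four ends at a vertex have one colour, with weight `-(A + A⁻¹)`;
minima and maxima preserve colours. Moves, skein relations and curls then become identities in a few
colours, checked in `Move.wordOp_eq` and `statePolynomial_isKauffmanVogel`. The circle has two
states, whence the factor `2⁻¹`.

A state of a diagram with `v` vertices contributes `(-(A + A⁻¹)) ^ v` times a power of `A`. At `A =
1` all these contributions have the same sign, so nothing cancels and the sum is nonzero as soon as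
there is a state (`isPositiveIff_stateSum`). States exist exactly for separable diagrams
(`GraphDiagram.separable_iff_isColorable`): given separating curves, let the colour change whenever
a curve is passed; given a state, draw the curves between edges of different colours.

For uniqueness, the difference of two solutions is extended by zero to all words. The skein
relations eliminate vertices and express the change of a crossing by `A - B` times the difference of
its smoothings. As `A ≠ B`, they also determine the value of an additional circle. Every tangle
without bottom ends thereby reduces to a linear combination of layered tangles, arcs stacked one
above the other (`IsSkeinFunctional.layeredClosed`). Without top ends only the empty word is left,
where the difference is zero. A polynomial in other variables is mapped to the target field by
`IsKauffmanVogel.map`, and uniqueness identifies the result with the state sum. -/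

theorem isTangle_cons_iff {n i m : ℕ} {p : Piece} {w : List Slice} :
    IsTangle n (⟨p, i⟩ :: w) m ↔ i + p.dom ≤ n ∧ IsTangle (n - p.dom + p.cod) w m := by
  constructor
  · intro h
    cases h with
    | cons p i r m w h =>
      refine ⟨by omega, ?_⟩
      have : i + p.dom + r - p.dom + p.cod = i + p.cod + r := by omega
      rwa [this]
  · rintro ⟨h, h'⟩
    obtain ⟨r, rfl⟩ := Nat.exists_eq_add_of_le h
    have : i + p.dom + r - p.dom + p.cod = i + p.cod + r := by omega
    rw [this] at h'
    exact .cons p i r m w h'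

theorem isTangle_nil_iff {n m : ℕ} : IsTangle n [] m ↔ n = m := by
  constructor
  · intro h
    cases h
    rfl
  · rintro rfl
    exact .nil n

theorem isTangle_append_iff {n m : ℕ} {u v : List Slice} :
    IsTangle n (u ++ v) m ↔ ∃ k, IsTangle n u k ∧ IsTangle k v m := by
  induction u generalizing n with
  | nil => simp [isTangle_nil_iff]
  | cons s u ih =>
    obtain ⟨p, i⟩ := s
    simp only [List.cons_append, isTangle_cons_iff, ih]
    constructor
    · rintro ⟨h, k, h1, h2⟩
      exact ⟨k, ⟨h, h1⟩, h2⟩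
    · rintro ⟨k, ⟨h, h1⟩, h2⟩
      exact ⟨h, k, h1, h2⟩

theorem IsTangle.target_unique {n m k : ℕ} {w : List Slice} (h : IsTangle n w m)
    (h' : IsTangle n w k) : m = k := by
  induction w generalizing n with
  | nil => exact (isTangle_nil_iff.1 h).symm.trans (isTangle_nil_iff.1 h')
  | cons s w ih =>
    obtain ⟨p, i⟩ := s
    exact ih (isTangle_cons_iff.1 h).2 (isTangle_cons_iff.1 h').2

theorem IsTangle.append {n m k : ℕ} {u v : List Slice} (h : IsTangle n u k)
    (h' : IsTangle k v m) : IsTangle n (u ++ v) m :=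
  isTangle_append_iff.2 ⟨k, h, h'⟩

theorem IsTangle.append_iff {n m k : ℕ} {u v : List Slice} (h : IsTangle n u k) :
    IsTangle n (u ++ v) m ↔ IsTangle k v m := by
  refine ⟨fun h' => ?_, h.append⟩
  obtain ⟨l, h1, h2⟩ := isTangle_append_iff.1 h'
  rwa [h.target_unique h1]

theorem Move.target_eq {s t : List Slice} (h : Move s t) {n k l : ℕ} (hs : IsTangle n s k)
    (ht : IsTangle n t l) : k = l := by
  cases h <;> simp only [isTangle_cons_iff, isTangle_nil_iff, Piece.dom, Piece.cod] at hs ht <;>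
    omega

/-! ### The state sum -/

section StateSum

variable {K : Type*} [Field K]

/-- The transfer operator of an elementary piece on functions of the colours of the strands. -/
def pieceOp (A : K) : Piece → (List Bool → K) → List Bool → K
  | .cup, g, [] => g [false, false] + g [true, true]
  | .cap, g, [p, q] => if p = q then g [] else 0
  -- The strand from `SW` to `NE` goes from colour `p` to `!p`, the other one from `q` to `!q`. If
  -- `p ≠ q`, the colours on the left and on the right are thus unchanged.
  | .node .overCross, g, [p, q] => (if p = q then A⁻¹ else A) * g [!q, !p]
  | .node .underCross, g, [p, q] => (if p = q then A else A⁻¹) * g [!q, !p]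
  -- Forced by the skein relation: crossing minus `A` times the identity minus `A⁻¹` times `∩∪`.
  | .node .vertex, g, [p, q] => if p = q then -(A + A⁻¹) * g [p, q] else 0
  | _, _, _ => 0

theorem pieceOp_linear (A a b : K) (p : Piece) (f g : List Bool → K) (c : List Bool) :
    pieceOp A p (fun d => a * f d + b * g d) c = a * pieceOp A p f c + b * pieceOp A p g c := by
  unfold pieceOp
  split <;> (try split_ifs) <;> ring

/-- Operators acting on different variables commute. Each value of the operator of `p` is zero, a
multiple of a value or a sum of two values, and the operator of `q` is linear. -/
theorem pieceOp_comm (A : K) (p q : Piece) (f : List Bool → List Bool → K) (c d : List Bool) :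
    pieceOp A p (fun x => pieceOp A q (f x) d) c =
      pieceOp A q (fun y => pieceOp A p (fun x => f x y) c) d := by
  have h0 : pieceOp A q (fun _ => 0) d = 0 := by
    simpa using pieceOp_linear A 0 0 q (fun _ => 0) (fun _ => 0) d
  have hmul (a : K) (o : List Bool) :
      a * pieceOp A q (f o) d = pieceOp A q (fun y => a * f o y) d := by
    simpa using (pieceOp_linear A a 0 q (f o) (f o) d).symm
  have hadd : pieceOp A q (f [false, false]) d + pieceOp A q (f [true, true]) d =
      pieceOp A q (fun y => f [false, false] y + f [true, true] y) d := by
    simpa using (pieceOp_linear A 1 1 q (f [false, false]) (f [true, true]) d).symm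
  rcases p with _ | _ | (_ | _ | _) <;> rcases c with _ | ⟨a, _ | ⟨b, _ | ⟨e, c⟩⟩⟩
  all_goals
    first
    | exact h0.symm
    | exact hadd
    | exact hmul _ _
    | by_cases hab : a = b
      · simpa only [pieceOp, hab, if_true] using hmul _ _
      · simpa only [pieceOp, hab, if_false] using h0.symm

/-- The transfer operator of a slice. -/
def sliceOp (A : K) (s : Slice) (f : List Bool → K) (c : List Bool) : K :=
  pieceOp A s.piece (fun o => f (c.take s.pos ++ o ++ c.drop (s.pos + s.piece.dom)))
    ((c.drop s.pos).take s.piece.dom)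

theorem sliceOp_append (A : K) (p : Piece) (f : List Bool → K) {i : ℕ} {x a y : List Bool}
    (hx : x.length = i) (ha : a.length = p.dom) :
    sliceOp A ⟨p, i⟩ f (x ++ (a ++ y)) = pieceOp A p (fun o => f (x ++ (o ++ y))) a := by
  subst hx
  simp [sliceOp, ← ha, List.drop_append, List.drop_eq_nil_of_le]

/-- The transfer operator of a word. -/
def wordOp (A : K) : List Slice → (List Bool → K) → List Bool → K
  | [], f => f
  | s :: w, f => sliceOp A s (wordOp A w f)

theorem wordOp_append (A : K) (u v : List Slice) (f : List Bool → K) :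
    wordOp A (u ++ v) f = wordOp A u (wordOp A v f) := by
  induction u with
  | nil => rfl
  | cons s u ih => simp [wordOp, ih]

theorem wordOp_linear (A a b : K) (w : List Slice) (f g : List Bool → K) (c : List Bool) :
    wordOp A w (fun d => a * f d + b * g d) c = a * wordOp A w f c + b * wordOp A w g c := by
  induction w generalizing c with
  | nil => rfl
  | cons s w ih =>
    simp only [wordOp, ← pieceOp_linear, sliceOp, ih]

theorem pieceOp_congr (A : K) (p : Piece) {f g : List Bool → K}
    (h : ∀ d, d.length = p.cod → f d = g d) (c : List Bool) : pieceOp A p f c = pieceOp A p g c := by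
  unfold pieceOp
  split <;> simp_all [Piece.cod]

/-- Local identities hold only for colour lists of the right length; this lemma allows their use
inside a longer word. -/
theorem wordOp_congr (A : K) {n m : ℕ} {w : List Slice} (hw : IsTangle n w m)
    {f g : List Bool → K} (h : ∀ d, d.length = m → f d = g d) {c : List Bool} (hc : c.length = n) :
    wordOp A w f c = wordOp A w g c := by
  induction hw generalizing c with
  | nil n => exact h c hc
  | cons p l r m w hw ih =>
    refine pieceOp_congr A p (fun d hd => ih h ?_) _
    simp [hc, hd]
    omega

/-! ### Explicit transfer operators of slices -/

section Local

variable (A : K) (f : List Bool → K) {i : ℕ} {x : List Bool} (hx : x.length = i) (y : List Bool)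
  (p q r : Bool)

include hx

theorem sliceOp_cup :
    sliceOp A (cup i) f (x ++ y) = f (x ++ false :: false :: y) + f (x ++ true :: true :: y) :=
  sliceOp_append A .cup f (a := []) hx rfl

theorem sliceOp_cap :
    sliceOp A (cap i) f (x ++ p :: q :: y) = if p = q then f (x ++ y) else 0 :=
  sliceOp_append A .cap f (a := [p, q]) hx rfl

theorem sliceOp_overCross :
    sliceOp A (overCross i) f (x ++ p :: q :: y) =
      (if p = q then A⁻¹ else A) * f (x ++ (!q) :: (!p) :: y) :=
  sliceOp_append A (.node .overCross) f (a := [p, q]) hx rfl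

theorem sliceOp_underCross :
    sliceOp A (underCross i) f (x ++ p :: q :: y) =
      (if p = q then A else A⁻¹) * f (x ++ (!q) :: (!p) :: y) :=
  sliceOp_append A (.node .underCross) f (a := [p, q]) hx rfl

theorem sliceOp_vertex :
    sliceOp A (vertex i) f (x ++ p :: q :: y) =
      if p = q then -(A + A⁻¹) * f (x ++ p :: q :: y) else 0 :=
  sliceOp_append A (.node .vertex) f (a := [p, q]) hx rfl

theorem sliceOp_cup_succ :
    sliceOp A (cup (i + 1)) f (x ++ p :: y) =
      f (x ++ p :: false :: false :: y) + f (x ++ p :: true :: true :: y) := by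
  simpa using sliceOp_cup A f (x := x ++ [p]) (i := i + 1) (by simp [hx]) y

theorem sliceOp_cap_succ :
    sliceOp A (cap (i + 1)) f (x ++ p :: q :: r :: y) = if q = r then f (x ++ p :: y) else 0 := by
  simpa using sliceOp_cap A f (x := x ++ [p]) (i := i + 1) (by simp [hx]) y q r

theorem sliceOp_overCross_succ :
    sliceOp A (overCross (i + 1)) f (x ++ p :: q :: r :: y) =
      (if q = r then A⁻¹ else A) * f (x ++ p :: (!r) :: (!q) :: y) := by
  simpa using sliceOp_overCross A f (x := x ++ [p]) (i := i + 1) (by simp [hx]) y q r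

theorem sliceOp_underCross_succ :
    sliceOp A (underCross (i + 1)) f (x ++ p :: q :: r :: y) =
      (if q = r then A else A⁻¹) * f (x ++ p :: (!r) :: (!q) :: y) := by
  simpa using sliceOp_underCross A f (x := x ++ [p]) (i := i + 1) (by simp [hx]) y q r

theorem sliceOp_vertex_succ :
    sliceOp A (vertex (i + 1)) f (x ++ p :: q :: r :: y) =
      if q = r then -(A + A⁻¹) * f (x ++ p :: q :: r :: y) else 0 := by
  simpa using sliceOp_vertex A f (x := x ++ [p]) (i := i + 1) (by simp [hx]) y q r

end Local

theorem exists_append_of_le_length {i : ℕ} {c : List Bool} (h : i ≤ c.length) :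
    ∃ x y, c = x ++ y ∧ x.length = i :=
  ⟨c.take i, c.drop i, (c.take_append_drop i).symm, by simpa⟩

theorem exists_append_one {i : ℕ} {c : List Bool} (h : i + 1 ≤ c.length) :
    ∃ x p y, c = x ++ p :: y ∧ x.length = i := by
  obtain ⟨x, y, rfl, hx⟩ := exists_append_of_le_length (i := i) (c := c) (by omega)
  rcases y with _ | ⟨p, y⟩
  · simp at h; omega
  · exact ⟨x, p, y, rfl, hx⟩

theorem exists_append_two {i : ℕ} {c : List Bool} (h : i + 2 ≤ c.length) :
    ∃ x p q y, c = x ++ p :: q :: y ∧ x.length = i := by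
  obtain ⟨x, p, y, rfl, hx⟩ := exists_append_one (i := i) (c := c) (by omega)
  rcases y with _ | ⟨q, y⟩
  · simp at h; omega
  · exact ⟨x, p, q, y, rfl, hx⟩

theorem exists_append_three {i : ℕ} {c : List Bool} (h : i + 3 ≤ c.length) :
    ∃ x p q r y, c = x ++ p :: q :: r :: y ∧ x.length = i := by
  obtain ⟨x, p, q, y, rfl, hx⟩ := exists_append_two (i := i) (c := c) (by omega)
  rcases y with _ | ⟨r, y⟩
  · simp at h; omega
  · exact ⟨x, p, q, r, y, rfl, hx⟩

/-! ### Invariance of the state sum and its skein relations -/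

theorem Move.wordOp_eq {A : K} (hA : A ≠ 0) {s t : List Slice} (h : Move s t) {n m : ℕ}
    (hs : IsTangle n s m) (ht : IsTangle n t m) (f : List Bool → K) {c : List Bool}
    (hc : c.length = n) : wordOp A s f c = wordOp A t f c := by
  subst hc
  cases h with
  | exchange p q i k =>
    simp only [isTangle_cons_iff] at hs ht
    obtain ⟨x, c', rfl, hx⟩ := exists_append_of_le_length (i := i) (c := c) (by omega)
    simp only [List.length_append] at hs ht
    obtain ⟨a, c', rfl, ha⟩ := exists_append_of_le_length (i := p.dom) (c := c') (by omega)
    simp only [List.length_append] at hs ht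
    obtain ⟨y, c', rfl, hy⟩ := exists_append_of_le_length (i := k) (c := c') (by omega)
    simp only [List.length_append] at hs ht
    obtain ⟨b, z, rfl, hb⟩ := exists_append_of_le_length (i := q.dom) (c := c') (by omega)
    simp only [wordOp]
    rw [sliceOp_append A p _ hx ha]
    have h1 : x ++ (a ++ (y ++ (b ++ z))) = (x ++ (a ++ y)) ++ (b ++ z) := by simp
    rw [h1, sliceOp_append A q _ (by simp; omega) hb]
    have h2 : ∀ o, o.length = p.cod → sliceOp A ⟨q, i + p.cod + k⟩ f (x ++ (o ++ (y ++ (b ++ z)))) =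
        pieceOp A q (fun o' => f (x ++ (o ++ (y ++ (o' ++ z))))) b := by
      intro o ho
      have h1 : x ++ (o ++ (y ++ (b ++ z))) = (x ++ (o ++ y)) ++ (b ++ z) := by simp
      rw [h1, sliceOp_append A q _ (by simp; omega) hb]
      simp
    have h3 : ∀ o, sliceOp A ⟨p, i⟩ f (x ++ (a ++ y) ++ (o ++ z)) =
        pieceOp A p (fun o' => f (x ++ (o' ++ (y ++ (o ++ z))))) a := by
      intro o
      have h1 : x ++ (a ++ y) ++ (o ++ z) = x ++ (a ++ (y ++ (o ++ z))) := by simp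
      rw [h1, sliceOp_append A p _ hx ha]
    rw [pieceOp_congr A p h2]
    simp only [h3]
    exact pieceOp_comm A p q (fun o o' => f (x ++ (o ++ (y ++ (o' ++ z))))) a b
  | zigzag i =>
    simp only [isTangle_cons_iff, Piece.dom, Piece.cod] at hs ht
    obtain ⟨x, p, y, rfl, hx⟩ := exists_append_one (i := i) (c := c) (by omega)
    cases p <;> simp [wordOp, sliceOp_cup A _ hx, sliceOp_cap_succ A _ hx]
  | zigzag' i =>
    simp only [isTangle_cons_iff, Piece.dom, Piece.cod] at hs ht
    obtain ⟨x, p, y, rfl, hx⟩ := exists_append_one (i := i) (c := c) (by omega)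
    cases p <;> simp [wordOp, sliceOp_cup_succ A _ hx, sliceOp_cap A _ hx]
  | turn_cup z i =>
    simp only [isTangle_cons_iff, Piece.dom, Piece.cod] at hs ht
    obtain ⟨x, p, y, rfl, hx⟩ := exists_append_one (i := i) (c := c) (by omega)
    cases z <;> cases p <;> simp [wordOp, Node.turn, sliceOp_cup_succ A _ hx, sliceOp_cup A _ hx,
      sliceOp_overCross_succ A _ hx, sliceOp_overCross A _ hx, sliceOp_underCross_succ A _ hx,
      sliceOp_underCross A _ hx, sliceOp_vertex_succ A _ hx, sliceOp_vertex A _ hx, add_comm]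
  | turn_cap z i =>
    simp only [isTangle_cons_iff, Piece.dom, Piece.cod] at hs ht
    obtain ⟨x, p, q, r, y, rfl, hx⟩ := exists_append_three (i := i) (c := c) (by omega)
    cases z <;> cases p <;> cases q <;> cases r <;> simp [wordOp, Node.turn,
      sliceOp_cap_succ A _ hx, sliceOp_cap A _ hx,
      sliceOp_overCross_succ A _ hx, sliceOp_overCross A _ hx, sliceOp_underCross_succ A _ hx,
      sliceOp_underCross A _ hx, sliceOp_vertex_succ A _ hx, sliceOp_vertex A _ hx]
  | reidemeister_two i =>
    simp only [isTangle_cons_iff, Piece.dom, Piece.cod] at hs ht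
    obtain ⟨x, p, q, y, rfl, hx⟩ := exists_append_two (i := i) (c := c) (by omega)
    cases p <;> cases q <;>
      simp [wordOp, sliceOp_overCross A _ hx, sliceOp_underCross A _ hx, hA]
  | reidemeister_two' i =>
    simp only [isTangle_cons_iff, Piece.dom, Piece.cod] at hs ht
    obtain ⟨x, p, q, y, rfl, hx⟩ := exists_append_two (i := i) (c := c) (by omega)
    cases p <;> cases q <;>
      simp [wordOp, sliceOp_overCross A _ hx, sliceOp_underCross A _ hx, hA]
  | reidemeister_three i =>
    simp only [isTangle_cons_iff, Piece.dom, Piece.cod] at hs ht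
    obtain ⟨x, p, q, r, y, rfl, hx⟩ := exists_append_three (i := i) (c := c) (by omega)
    cases p <;> cases q <;> cases r <;>
      simp [wordOp, sliceOp_overCross_succ A _ hx, sliceOp_overCross A _ hx, hA]
  | strand_over_vertex i =>
    simp only [isTangle_cons_iff, Piece.dom, Piece.cod] at hs ht
    obtain ⟨x, p, q, r, y, rfl, hx⟩ := exists_append_three (i := i) (c := c) (by omega)
    cases p <;> cases q <;> cases r <;>
      simp [wordOp, sliceOp_overCross_succ A _ hx, sliceOp_overCross A _ hx,
        sliceOp_vertex_succ A _ hx, sliceOp_vertex A _ hx, hA]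
  | strand_under_vertex i =>
    simp only [isTangle_cons_iff, Piece.dom, Piece.cod] at hs ht
    obtain ⟨x, p, q, r, y, rfl, hx⟩ := exists_append_three (i := i) (c := c) (by omega)
    cases p <;> cases q <;> cases r <;>
      simp [wordOp, sliceOp_underCross_succ A _ hx, sliceOp_underCross A _ hx,
        sliceOp_vertex_succ A _ hx, sliceOp_vertex A _ hx, hA]
  | flip_vertex i =>
    simp only [isTangle_cons_iff, Piece.dom, Piece.cod] at hs ht
    obtain ⟨x, p, q, y, rfl, hx⟩ := exists_append_two (i := i) (c := c) (by omega)
    cases p <;> cases q <;>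
      simp [wordOp, sliceOp_overCross A _ hx, sliceOp_vertex A _ hx, mul_left_comm]

/-- The state sum of a word, relative to the colours at the bottom, if there are no strands at the
top. -/
def stateSum (A : K) (w : List Slice) : List Bool → K :=
  wordOp A w fun c => if c = [] then 1 else 0

theorem stateSum_append_append (A : K) (u s v : List Slice) :
    stateSum A (u ++ s ++ v) [] = wordOp A u (wordOp A s (stateSum A v)) [] := by
  simp only [stateSum, wordOp_append]

/-- The Kauffman--Vogel polynomial at `B = A⁻¹` and `a = A`. -/
def statePolynomial (A : K) (G : GraphDiagram) : K :=
  2⁻¹ * stateSum A G.word []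

/-- A local relation above `u` survives the application of the operator of `u`, which is linear. -/
theorem stateSum_linear_relation (A : K) {u s t v : List Slice} (h : IsTangle 0 (u ++ s ++ v) 0)
    (b : K) (hst : ∀ n m, IsTangle n s m → ∀ (f : List Bool → K) c, c.length = n →
      wordOp A s f c = b * wordOp A t f c) :
    stateSum A (u ++ s ++ v) [] = b * stateSum A (u ++ t ++ v) [] := by
  obtain ⟨m, h1, -⟩ := isTangle_append_iff.1 h
  obtain ⟨n, h2, h3⟩ := isTangle_append_iff.1 h1
  rw [stateSum_append_append, stateSum_append_append,
    wordOp_congr A h2 (fun d hd => hst n m h3 (stateSum A v) d hd) rfl]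
  simpa using wordOp_linear A b 0 u (wordOp A t (stateSum A v)) (fun _ => 0) []

theorem stateSum_skein (A : K) {u s t₁ t₂ t₃ v : List Slice} (h : IsTangle 0 (u ++ s ++ v) 0)
    (a b : K) (hst : ∀ n m, IsTangle n s m → ∀ (f : List Bool → K) c, c.length = n →
      wordOp A s f c = a * wordOp A t₁ f c + b * wordOp A t₂ f c + wordOp A t₃ f c) :
    stateSum A (u ++ s ++ v) [] = a * stateSum A (u ++ t₁ ++ v) [] +
      b * stateSum A (u ++ t₂ ++ v) [] + stateSum A (u ++ t₃ ++ v) [] := by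
  obtain ⟨m, h1, -⟩ := isTangle_append_iff.1 h
  obtain ⟨n, h2, h3⟩ := isTangle_append_iff.1 h1
  simp only [stateSum_append_append]
  rw [wordOp_congr A h2 (fun d hd => hst n m h3 (stateSum A v) d hd) rfl, ← wordOp_linear]
  simpa using wordOp_linear A 1 1 u (fun d => a * wordOp A t₁ (stateSum A v) d +
    b * wordOp A t₂ (stateSum A v) d) (wordOp A t₃ (stateSum A v)) []

theorem statePolynomial_isKauffmanVogel [CharZero K] {A : K} (hA : A ≠ 0) :
    IsKauffmanVogel A A⁻¹ (Units.mk0 A hA) (statePolynomial A) where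
  regular_isotopy G H u v s t hst hG hH := by
    have h1 := G.closed
    have h2 := H.closed
    rw [hG] at h1
    rw [hH] at h2
    obtain ⟨m, h3, h4⟩ := isTangle_append_iff.1 h1
    obtain ⟨n, h5, h6⟩ := isTangle_append_iff.1 h3
    obtain ⟨m', h3', h4'⟩ := isTangle_append_iff.1 h2
    have h6' := h5.append_iff.1 h3'
    obtain rfl := hst.target_eq h6 h6'
    simp only [statePolynomial]
    rw [hG, hH, stateSum_append_append, stateSum_append_append,
      wordOp_congr A h5 (fun d hd => hst.wordOp_eq hA h6 h6' _ hd) rfl]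
  skein_over X V H W u v i hX hV hH hW := by
    have h := X.closed
    rw [hX] at h
    simp only [statePolynomial]
    rw [hX, hV, hH, hW, stateSum_skein A (t₁ := []) (t₂ := [cap i, cup i]) (t₃ := [vertex i]) h A A⁻¹]
    · simp only [List.append_nil]
      ring
    · intro n m hs f c hc
      simp only [isTangle_cons_iff, Piece.dom, Piece.cod] at hs
      obtain ⟨x, p, q, y, rfl, hx⟩ := exists_append_two (i := i) (c := c) (by omega)
      cases p <;> cases q <;> simp [wordOp, sliceOp_overCross A _ hx, sliceOp_cap A _ hx,
        sliceOp_cup A _ hx, sliceOp_vertex A _ hx] <;> ring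
  skein_under X V H W u v i hX hV hH hW := by
    have h := X.closed
    rw [hX] at h
    simp only [statePolynomial]
    rw [hX, hV, hH, hW, stateSum_skein A (t₁ := [cap i, cup i]) (t₂ := []) (t₃ := [vertex i]) h A A⁻¹]
    · simp only [List.append_nil]
      ring
    · intro n m hs f c hc
      simp only [isTangle_cons_iff, Piece.dom, Piece.cod] at hs
      obtain ⟨x, p, q, y, rfl, hx⟩ := exists_append_two (i := i) (c := c) (by omega)
      cases p <;> cases q <;> simp [wordOp, sliceOp_underCross A _ hx, sliceOp_cap A _ hx,
        sliceOp_cup A _ hx, sliceOp_vertex A _ hx] <;> ring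
  curl_pos T S u v i hT hS := by
    have h := T.closed
    simp only [statePolynomial]
    rcases hT with hT | hT <;> rw [hT] at h <;>
      rw [hT, hS, stateSum_linear_relation A (t := []) h A, List.append_nil, Units.val_mk0,
        mul_left_comm] <;> intro n m hs f c hc <;>
      simp only [isTangle_cons_iff, Piece.dom, Piece.cod] at hs <;>
      obtain ⟨x, p, y, rfl, hx⟩ := exists_append_one (i := i) (c := c) (by omega) <;>
      -- In a curl the colours at the two ends agree and determine the colour of the loop. The two
      -- strands meeting at the crossing then differ in colour, so that the weight is `A`.
      cases p <;> simp [wordOp, sliceOp_cup_succ A _ hx, sliceOp_cup A _ hx,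
        sliceOp_overCross_succ A _ hx, sliceOp_overCross A _ hx, sliceOp_cap_succ A _ hx,
        sliceOp_cap A _ hx]
  curl_neg T S u v i hT hS := by
    have h := T.closed
    simp only [statePolynomial]
    rcases hT with hT | hT <;> rw [hT] at h <;>
      rw [hT, hS, stateSum_linear_relation A (t := []) h A⁻¹, List.append_nil, Units.val_inv_eq_inv_val,
        Units.val_mk0, mul_left_comm] <;> intro n m hs f c hc <;>
      simp only [isTangle_cons_iff, Piece.dom, Piece.cod] at hs <;>
      obtain ⟨x, p, y, rfl, hx⟩ := exists_append_one (i := i) (c := c) (by omega) <;>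
      cases p <;> simp [wordOp, sliceOp_cup_succ A _ hx, sliceOp_cup A _ hx,
        sliceOp_underCross_succ A _ hx, sliceOp_underCross A _ hx, sliceOp_cap_succ A _ hx,
        sliceOp_cap A _ hx]
  unknot_eq_one := by
    simp [statePolynomial, unknot, stateSum, wordOp, sliceOp, pieceOp, Piece.dom]
    norm_num

end StateSum

/-! ### Uniqueness -/

theorem Piece.dom_cup : Piece.cup.dom = 0 := rfl

theorem Piece.cod_cup : Piece.cup.cod = 2 := rfl

theorem Piece.dom_node (x : Node) : (Piece.node x).dom = 2 := rfl

theorem Piece.cod_node (x : Node) : (Piece.node x).cod = 2 := rfl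

section Uniqueness

/-! ### Tangles up to closure, and layered tangles -/

section

variable {K : Type*}

/-- Two tangles with the same ends whose closures have the same value. -/
structure TangleEquiv (D : List Slice → K) (n m : ℕ) (s t : List Slice) : Prop where
  left : IsTangle n s m
  right : IsTangle n t m
  eq : ∀ u v, IsTangle 0 u n → D (u ++ s ++ v) = D (u ++ t ++ v)

/-- The value of the closures of a tangle. -/
def closureValue (D : List Slice → K) (w v : List Slice) : K := D (w ++ v)

theorem TangleEquiv.closureValue_eq {D : List Slice → K} {n m : ℕ} {s t w : List Slice}
    (h : TangleEquiv D n m s t) (hw : IsTangle 0 w n) :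
    closureValue D (w ++ s) = closureValue D (w ++ t) :=
  funext fun v => h.eq w v hw

theorem TangleEquiv.symm {D : List Slice → K} {n m : ℕ} {s t : List Slice}
    (h : TangleEquiv D n m s t) : TangleEquiv D n m t s :=
  ⟨h.right, h.left, fun u v hu => (h.eq u v hu).symm⟩

theorem TangleEquiv.trans {D : List Slice → K} {n m : ℕ} {s t r : List Slice}
    (h : TangleEquiv D n m s t) (h' : TangleEquiv D n m t r) : TangleEquiv D n m s r :=
  ⟨h.left, h'.right, fun u v hu => (h.eq u v hu).trans (h'.eq u v hu)⟩

theorem TangleEquiv.append_left {D : List Slice → K} {n m k : ℕ} {s t u : List Slice}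
    (h : TangleEquiv D n m s t) (hu : IsTangle k u n) : TangleEquiv D k m (u ++ s) (u ++ t) :=
  ⟨hu.append h.left, hu.append h.right, fun w v hw => by
    simpa using h.eq (w ++ u) v (hw.append hu)⟩

theorem TangleEquiv.append_right {D : List Slice → K} {n m k : ℕ} {s t v : List Slice}
    (h : TangleEquiv D n m s t) (hv : IsTangle m v k) : TangleEquiv D n k (s ++ v) (t ++ v) :=
  ⟨h.left.append hv, h.right.append hv, fun w z hw => by
    simpa using h.eq w (v ++ z) hw⟩

/-- The tangle which adds an arc joining the leftmost strand to the strand `k + 1`, above all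
other strands. -/
def arc : ℕ → List Slice
  | 0 => [cup 0]
  | k + 1 => arc k ++ [overCross (k + 1)]

theorem arc_isTangle {m k : ℕ} (h : k ≤ m) : IsTangle m (arc k) (m + 2) := by
  induction k with
  | zero => simp [arc, isTangle_cons_iff, isTangle_nil_iff, Piece.dom, Piece.cod]
  | succ k ih =>
    refine (ih (by omega)).append ?_
    simp [isTangle_cons_iff, isTangle_nil_iff, Piece.dom, Piece.cod]
    omega

/-- The words which add `n` arcs, one above the other. -/
inductive IsLayered : ℕ → List Slice → Prop
  | nil : IsLayered 0 []
  | arc {n k : ℕ} {w : List Slice} : IsLayered n w → k ≤ 2 * n → IsLayered (n + 1) (w ++ arc k)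

theorem IsLayered.isTangle {n : ℕ} {w : List Slice} (h : IsLayered n w) :
    IsTangle 0 w (2 * n) := by
  induction h with
  | nil => exact .nil 0
  | arc h hk ih => exact ih.append (arc_isTangle hk)

end

variable {K : Type*} [Field K]

/-- The action of tangles on functions of closures. -/
def stackMap (K : Type*) [Field K] (s : List Slice) :
    (List Slice → K) →ₗ[K] (List Slice → K) where
  toFun f v := f (s ++ v)
  map_add' _ _ := rfl
  map_smul' _ _ := rfl

theorem stackMap_closureValue (D : List Slice → K) (s w : List Slice) :
    stackMap K s (closureValue D w) = closureValue D (w ++ s) := by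
  ext v
  simp [stackMap, closureValue]

/-- The span of the values of the layered tangles. -/
def layeredSpan (D : List Slice → K) (n : ℕ) : Submodule K (List Slice → K) :=
  Submodule.span K (closureValue D '' {w | IsLayered n w})

theorem IsLayered.mem_layeredSpan (D : List Slice → K) {n : ℕ} {w : List Slice}
    (h : IsLayered n w) : closureValue D w ∈ layeredSpan D n :=
  Submodule.subset_span ⟨w, h, rfl⟩

theorem layeredSpan_stackMap {D : List Slice → K} {n m : ℕ} {s : List Slice}
    (h : ∀ w, IsLayered n w → closureValue D (w ++ s) ∈ layeredSpan D m) {f : List Slice → K}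
    (hf : f ∈ layeredSpan D n) : stackMap K s f ∈ layeredSpan D m := by
  have : layeredSpan D n ≤ (layeredSpan D m).comap (stackMap K s) := by
    refine Submodule.span_le.2 ?_
    rintro _ ⟨w, hw, rfl⟩
    simpa [stackMap_closureValue] using h w hw
  exact this hf

theorem layeredSpan_arc {D : List Slice → K} {n k : ℕ} (hk : k ≤ 2 * n) {w : List Slice}
    (hw : closureValue D w ∈ layeredSpan D n) :
    closureValue D (w ++ arc k) ∈ layeredSpan D (n + 1) := by
  rw [← stackMap_closureValue]
  exact layeredSpan_stackMap (fun w hw => (hw.arc hk).mem_layeredSpan D) hw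

/-- The difference of two Kauffman--Vogel polynomials, as a function of words. -/
structure IsSkeinFunctional (A B : K) (a : K) (D : List Slice → K) : Prop where
  -- With this convention, identities between closures hold for arbitrary lists `v` on top, not only
  -- for those that close the tangle.
  eq_zero : ∀ w, ¬ IsTangle 0 w 0 → D w = 0
  nil : D [] = 0
  unknot : D [cup 0, cap 0] = 0
  move : ∀ {u s t v : List Slice}, Move s t → IsTangle 0 (u ++ s ++ v) 0 →
    IsTangle 0 (u ++ t ++ v) 0 → D (u ++ s ++ v) = D (u ++ t ++ v)
  skein_over : ∀ {u v : List Slice} {i : ℕ}, IsTangle 0 (u ++ [overCross i] ++ v) 0 →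
    D (u ++ [overCross i] ++ v) =
      A * D (u ++ v) + B * D (u ++ [cap i, cup i] ++ v) + D (u ++ [vertex i] ++ v)
  skein_under : ∀ {u v : List Slice} {i : ℕ}, IsTangle 0 (u ++ [underCross i] ++ v) 0 →
    D (u ++ [underCross i] ++ v) =
      A * D (u ++ [cap i, cup i] ++ v) + B * D (u ++ v) + D (u ++ [vertex i] ++ v)
  curl_over : ∀ {u v : List Slice} {i : ℕ},
    IsTangle 0 (u ++ [cup i, overCross (i + 1), cap i] ++ v) 0 →
    D (u ++ [cup i, overCross (i + 1), cap i] ++ v) = a * D (u ++ v)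
  curl_under : ∀ {u v : List Slice} {i : ℕ},
    IsTangle 0 (u ++ [cup i, underCross (i + 1), cap i] ++ v) 0 →
    D (u ++ [cup i, underCross (i + 1), cap i] ++ v) = a⁻¹ * D (u ++ v)

/-- The values of layered tangles with `n` arcs followed by one slice without a vertex are linear
combinations of values of layered tangles. -/
structure LayeredClosed (D : List Slice → K) (n : ℕ) : Prop where
  cup_mem : ∀ {i w}, i ≤ 2 * n → closureValue D w ∈ layeredSpan D n →
    closureValue D (w ++ [cup i]) ∈ layeredSpan D (n + 1)
  cap_mem : ∀ {i w}, i + 2 ≤ 2 * n → closureValue D w ∈ layeredSpan D n →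
    closureValue D (w ++ [cap i]) ∈ layeredSpan D (n - 1)
  over_mem : ∀ {i w}, i + 2 ≤ 2 * n → closureValue D w ∈ layeredSpan D n →
    closureValue D (w ++ [overCross i]) ∈ layeredSpan D n
  under_mem : ∀ {i w}, i + 2 ≤ 2 * n → closureValue D w ∈ layeredSpan D n →
    closureValue D (w ++ [underCross i]) ∈ layeredSpan D n

theorem layeredSpan_slice {D : List Slice → K} {n m : ℕ} {s : Slice}
    (h : ∀ w, IsLayered n w → closureValue D (w ++ [s]) ∈ layeredSpan D m) {w : List Slice}
    (hw : closureValue D w ∈ layeredSpan D n) : closureValue D (w ++ [s]) ∈ layeredSpan D m := by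
  rw [← stackMap_closureValue]
  exact layeredSpan_stackMap h hw

/-! ### Local relations satisfied by a skein functional -/

namespace IsSkeinFunctional

variable {A B a : K} {D : List Slice → K} (hD : IsSkeinFunctional A B a D)

include hD

theorem tangleEquiv {n m : ℕ} {s t : List Slice} (h : Move s t) (hs : IsTangle n s m)
    (ht : IsTangle n t m) : TangleEquiv D n m s t := by
  refine ⟨hs, ht, fun u v hu => ?_⟩
  by_cases hv : IsTangle m v 0
  · exact hD.move h ((hu.append hs).append hv) ((hu.append ht).append hv)
  · rw [hD.eq_zero, hD.eq_zero]
    · rwa [(hu.append ht).append_iff]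
    · rwa [(hu.append hs).append_iff]

theorem closureValue_over {n i : ℕ} {w : List Slice} (hw : IsTangle 0 w n) (hi : i + 2 ≤ n) :
    closureValue D (w ++ [overCross i]) = A • closureValue D w +
      B • closureValue D (w ++ [cap i, cup i]) + closureValue D (w ++ [vertex i]) := by
  ext v
  by_cases hv : IsTangle n v 0
  · refine hD.skein_over ((hw.append ?_).append hv)
    simp [isTangle_cons_iff, isTangle_nil_iff, Piece.dom, Piece.cod]
    omega
  · have h (s : List Slice) (hs : IsTangle n s n) : D (w ++ s ++ v) = 0 :=
      hD.eq_zero _ (by rwa [(hw.append hs).append_iff])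
    have h1 := h [overCross i]
    have h2 := h [] (.nil n)
    have h3 := h [cap i, cup i]
    have h4 := h [vertex i]
    simp [isTangle_cons_iff, isTangle_nil_iff, Piece.dom, Piece.cod] at h1 h2 h3 h4
    simp [closureValue, h1 (by omega) (by omega), h2, h3 (by omega) (by omega) (by omega),
      h4 (by omega) (by omega)]

theorem closureValue_under {n i : ℕ} {w : List Slice} (hw : IsTangle 0 w n) (hi : i + 2 ≤ n) :
    closureValue D (w ++ [underCross i]) = A • closureValue D (w ++ [cap i, cup i]) +
      B • closureValue D w + closureValue D (w ++ [vertex i]) := by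
  ext v
  by_cases hv : IsTangle n v 0
  · refine hD.skein_under ((hw.append ?_).append hv)
    simp [isTangle_cons_iff, isTangle_nil_iff, Piece.dom, Piece.cod]
    omega
  · have h (s : List Slice) (hs : IsTangle n s n) : D (w ++ s ++ v) = 0 :=
      hD.eq_zero _ (by rwa [(hw.append hs).append_iff])
    have h1 := h [underCross i]
    have h2 := h [] (.nil n)
    have h3 := h [cap i, cup i]
    have h4 := h [vertex i]
    simp [isTangle_cons_iff, isTangle_nil_iff, Piece.dom, Piece.cod] at h1 h2 h3 h4
    simp [closureValue, h1 (by omega) (by omega), h2, h3 (by omega) (by omega) (by omega),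
      h4 (by omega) (by omega)]

/-- The vertex terms of the two skein relations cancel. What is left is the relation of the
Dubrovnik polynomial, which permits changing crossings. -/
theorem closureValue_over_sub_under {n i : ℕ} {w : List Slice} (hw : IsTangle 0 w n)
    (hi : i + 2 ≤ n) :
    closureValue D (w ++ [overCross i]) = closureValue D (w ++ [underCross i]) +
      (A - B) • (closureValue D w - closureValue D (w ++ [cap i, cup i])) := by
  rw [hD.closureValue_over hw hi, hD.closureValue_under hw hi]
  module

theorem closureValue_curl_over {n i : ℕ} {w : List Slice} (hw : IsTangle 0 w n)
    (hi : i + 1 ≤ n) :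
    closureValue D (w ++ [cup i, overCross (i + 1), cap i]) = a • closureValue D w := by
  have ht : IsTangle n [cup i, overCross (i + 1), cap i] n := by
    simp only [isTangle_cons_iff, isTangle_nil_iff, Piece.dom, Piece.cod]
    omega
  ext v
  by_cases hv : IsTangle n v 0
  · exact hD.curl_over ((hw.append ht).append hv)
  · simp only [closureValue, Pi.smul_apply, smul_eq_mul]
    rw [hD.eq_zero _ (by rwa [(hw.append ht).append_iff]), hD.eq_zero _ (by rwa [hw.append_iff]),
      mul_zero]

theorem closureValue_curl_under {n i : ℕ} {w : List Slice} (hw : IsTangle 0 w n)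
    (hi : i + 1 ≤ n) :
    closureValue D (w ++ [cup i, underCross (i + 1), cap i]) = a⁻¹ • closureValue D w := by
  have ht : IsTangle n [cup i, underCross (i + 1), cap i] n := by
    simp only [isTangle_cons_iff, isTangle_nil_iff, Piece.dom, Piece.cod]
    omega
  ext v
  by_cases hv : IsTangle n v 0
  · exact hD.curl_under ((hw.append ht).append hv)
  · simp only [closureValue, Pi.smul_apply, smul_eq_mul]
    rw [hD.eq_zero _ (by rwa [(hw.append ht).append_iff]), hD.eq_zero _ (by rwa [hw.append_iff]),
      mul_zero]

/-- This is `Move.exchange` read backwards, with positions related by equations of sums, to avoid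
truncated subtraction when `p` is a maximum. -/
theorem slide {n m i j j' : ℕ} (p q : Piece) (hj : i + p.dom ≤ j)
    (hj' : j' + p.dom = j + p.cod) (hn : j + q.dom ≤ n)
    (hm : m + p.dom + q.dom = n + p.cod + q.cod) :
    TangleEquiv D n m [⟨q, j⟩, ⟨p, i⟩] [⟨p, i⟩, ⟨q, j'⟩] := by
  obtain ⟨k, rfl⟩ := Nat.exists_eq_add_of_le hj
  obtain rfl : j' = i + p.cod + k := by omega
  refine (hD.tangleEquiv (.exchange p q i k) ?_ ?_).symm <;>
    simp only [isTangle_cons_iff, isTangle_nil_iff] <;> omega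

theorem over_under {n i : ℕ} (hi : i + 2 ≤ n) :
    TangleEquiv D n n [overCross i, underCross i] [] := by
  refine hD.tangleEquiv (.reidemeister_two i) ?_ (.nil n)
  simp only [isTangle_cons_iff, isTangle_nil_iff, Piece.dom, Piece.cod]
  omega

theorem under_over {n i : ℕ} (hi : i + 2 ≤ n) :
    TangleEquiv D n n [underCross i, overCross i] [] := by
  refine hD.tangleEquiv (.reidemeister_two' i) ?_ (.nil n)
  simp only [isTangle_cons_iff, isTangle_nil_iff, Piece.dom, Piece.cod]
  omega

theorem cup_cap {n i : ℕ} (hi : i + 1 ≤ n) : TangleEquiv D n n [cup i, cap (i + 1)] [] := by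
  refine hD.tangleEquiv (.zigzag i) ?_ (.nil n)
  simp only [isTangle_cons_iff, isTangle_nil_iff, Piece.dom, Piece.cod]
  omega

theorem cup_cap' {n i : ℕ} (hi : i + 1 ≤ n) : TangleEquiv D n n [cup (i + 1), cap i] [] := by
  refine hD.tangleEquiv (.zigzag' i) ?_ (.nil n)
  simp only [isTangle_cons_iff, isTangle_nil_iff, Piece.dom, Piece.cod]
  omega

theorem turn_cup (x : Node) {n i : ℕ} (hi : i + 1 ≤ n) :
    TangleEquiv D n (n + 2) [cup i, node x (i + 1)] [cup (i + 1), node x.turn i] := by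
  refine hD.tangleEquiv (.turn_cup x i) ?_ ?_ <;>
    simp only [isTangle_cons_iff, isTangle_nil_iff, Piece.dom, Piece.cod] <;> omega

theorem turn_cap (x : Node) {n i : ℕ} (hi : i + 1 ≤ n) :
    TangleEquiv D (n + 2) n [node x (i + 1), cap i] [node x.turn i, cap (i + 1)] := by
  refine hD.tangleEquiv (.turn_cap x i) ?_ ?_ <;>
    simp only [isTangle_cons_iff, isTangle_nil_iff, Piece.dom, Piece.cod] <;> omega

theorem braid {n i : ℕ} (hi : i + 3 ≤ n) :
    TangleEquiv D n n [overCross i, overCross (i + 1), overCross i]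
      [overCross (i + 1), overCross i, overCross (i + 1)] := by
  refine hD.tangleEquiv (.reidemeister_three i) ?_ ?_ <;>
    simp only [isTangle_cons_iff, isTangle_nil_iff, Piece.dom, Piece.cod] <;> omega

/-- A minimum slides below a strand: after turning one crossing around the minimum, the two
crossings cancel. -/
theorem cup_over_over {n i : ℕ} (hi : i + 1 ≤ n) :
    TangleEquiv D n (n + 2) [cup (i + 1), overCross i, overCross (i + 1)] [cup i] := by
  have h1 := (hD.turn_cup .underCross hi).symm.append_right (v := [overCross (i + 1)]) (k := n + 2)
    (by simp only [isTangle_cons_iff, isTangle_nil_iff, Piece.dom, Piece.cod]; omega)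
  have h2 := (hD.under_over (n := n + 2) (i := i + 1) (by omega)).append_left (u := [cup i]) (k := n)
    (by simp only [isTangle_cons_iff, isTangle_nil_iff, Piece.dom, Piece.cod]; omega)
  exact h1.trans h2

theorem over_over_cap {n i : ℕ} (hi : i + 1 ≤ n) :
    TangleEquiv D (n + 2) n [overCross i, overCross (i + 1), cap i] [cap (i + 1)] := by
  have h1 := (hD.turn_cap .overCross hi).append_left (u := [overCross i]) (k := n + 2)
    (by simp only [isTangle_cons_iff, isTangle_nil_iff, Piece.dom, Piece.cod]; omega)
  have h2 := (hD.over_under (n := n + 2) (i := i) (by omega)).append_right (v := [cap (i + 1)])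
    (k := n) (by simp only [isTangle_cons_iff, isTangle_nil_iff, Piece.dom, Piece.cod]; omega)
  exact h1.trans h2

/-- A zigzag is inserted in order to see the loop as a curl on one strand. The crossing gets turned
around the new minimum, so it becomes an `underCross` and the factor is `a⁻¹`. -/
theorem closureValue_over_cap {n i : ℕ} {w : List Slice} (hw : IsTangle 0 w (n + 2))
    (hi : i ≤ n) :
    closureValue D (w ++ [overCross i, cap i]) = a⁻¹ • closureValue D (w ++ [cap i]) := by
  have h1 := (hD.cup_cap (n := n + 2) (i := i + 1) (by omega)).symm.append_right
    (v := [overCross i, cap i]) (k := n)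
    (by simp only [isTangle_cons_iff, isTangle_nil_iff, Piece.dom, Piece.cod]; omega)
  have h2 := ((hD.slide (n := n + 4) (m := n + 2) (.node .overCross) .cap (i := i) (j := i + 2)
    (j' := i + 2) le_rfl rfl (by simp only [Piece.dom]; omega) rfl).append_left
      (u := [cup (i + 1)]) (k := n + 2)
      (by simp only [isTangle_cons_iff, isTangle_nil_iff, Piece.dom, Piece.cod]; omega)).append_right
      (v := [cap i]) (k := n)
      (by simp only [isTangle_cons_iff, isTangle_nil_iff, Piece.dom, Piece.cod]; omega)
  have h3 := (hD.slide (n := n + 4) (m := n) .cap .cap (i := i) (j := i + 2)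
    (j' := i) le_rfl rfl (by simp only [Piece.dom]; omega) rfl).append_left
      (u := [cup (i + 1), overCross i]) (k := n + 2)
      (by simp only [isTangle_cons_iff, isTangle_nil_iff, Piece.dom, Piece.cod]; omega)
  have h4 := (hD.turn_cup (n := n + 2) (i := i) .underCross (by omega)).symm.append_right
    (v := [cap i, cap i]) (k := n)
    (by simp only [isTangle_cons_iff, isTangle_nil_iff, Piece.dom, Piece.cod]; omega)
  have h := ((h1.trans h2).trans (h3.trans h4)).closureValue_eq hw
  have h5 := congr_arg (stackMap K [cap i])
    (hD.closureValue_curl_under (i := i) hw (by omega))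
  rw [map_smul, stackMap_closureValue, stackMap_closureValue] at h5
  rw [← h5]
  simpa using h

theorem closureValue_cup_over {n i : ℕ} {w : List Slice} (hw : IsTangle 0 w n)
    (hi : i ≤ n) :
    closureValue D (w ++ [cup i, overCross i]) = a⁻¹ • closureValue D (w ++ [cup i]) := by
  have h1 := (hD.cup_cap' (n := n + 2) (i := i + 1) (by omega)).symm.append_left
    (u := [cup i, overCross i]) (k := n)
    (by simp only [isTangle_cons_iff, isTangle_nil_iff, Piece.dom, Piece.cod]; omega)
  have h2 := ((hD.slide (n := n + 2) (m := n + 4) (.node .overCross) .cup (i := i) (j := i + 2)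
    (j' := i + 2) le_rfl rfl (by simp only [Piece.dom]; omega) rfl).symm.append_left
      (u := [cup i]) (k := n)
      (by simp only [isTangle_cons_iff, isTangle_nil_iff, Piece.dom, Piece.cod]; omega)).append_right
      (v := [cap (i + 1)]) (k := n + 2)
      (by simp only [isTangle_cons_iff, isTangle_nil_iff, Piece.dom, Piece.cod]; omega)
  have h3 := (hD.slide (n := n) (m := n + 4) .cup .cup (i := i) (j := i)
    (j' := i + 2) le_rfl rfl (by simp only [Piece.dom]; omega) rfl).symm.append_right
      (v := [overCross i, cap (i + 1)]) (k := n + 2)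
      (by simp only [isTangle_cons_iff, isTangle_nil_iff, Piece.dom, Piece.cod]; omega)
  have h4 := (hD.turn_cap (n := n + 2) (i := i) .underCross (by omega)).symm.append_left
    (u := [cup i, cup i]) (k := n)
    (by simp only [isTangle_cons_iff, isTangle_nil_iff, Piece.dom, Piece.cod]; omega)
  have h := ((h1.trans h2).trans (h3.trans h4)).closureValue_eq hw
  have h5 := hD.closureValue_curl_under (i := i) (n := n + 2) (w := w ++ [cup i])
    (hw.append (by simp only [isTangle_cons_iff, isTangle_nil_iff, Piece.dom, Piece.cod]; omega))
    (by omega)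
  rw [← h5]
  simpa using h

/-! #### Sliding below an arc -/

/-- After `arc k` the right foot of the arc is strand `k + 1`; pieces further to the right move past
all of the arc. -/
theorem arc_far (p : Piece) {n m k i : ℕ} (hi : k + i + p.dom ≤ n) (hm : m + p.dom = n + p.cod) :
    TangleEquiv D n (m + 2) (arc k ++ [⟨p, k + 2 + i⟩]) ([⟨p, k + i⟩] ++ arc k) := by
  induction k generalizing i with
  | zero =>
    refine (hD.slide (i := 0) (j := 0 + i) (j' := 0 + 2 + i) .cup p ?_ ?_ ?_ ?_).symm <;>
      (try simp only [Piece.dom_cup, Piece.cod_cup]) <;> omega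
  | succ k ih =>
    have h1 := (hD.slide (n := n + 2) (m := m + 2) (i := k + 1) (j := k + 1 + 2 + i)
      (j' := k + 1 + 2 + i) (.node .overCross) p (by simp only [Piece.dom_node]; omega) rfl (by omega)
      (by simp only [Piece.dom_node, Piece.cod_node]; omega)).symm.append_left (arc_isTangle (m := n) (k := k)
        (by omega))
    have h2 := (ih (i := i + 1) (by omega)).append_right (v := [overCross (k + 1)]) (k := m + 2)
      (by simp only [isTangle_cons_iff, isTangle_nil_iff, Piece.dom, Piece.cod]; omega)
    rw [show k + 2 + (i + 1) = k + 1 + 2 + i by omega, show k + (i + 1) = k + 1 + i by omega] at h2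
    simpa [arc] using h1.trans (by simpa using h2)

/-- The arc lies above everything, so a minimum between its feet can be moved below it. The arc then
spans two more strands. The induction is on the number of crossings of the arc to the right of the
minimum. -/
theorem arc_cup {n k i : ℕ} (hi : i ≤ k) (hk : k ≤ n) :
    TangleEquiv D n (n + 4) (arc k ++ [cup (i + 1)]) ([cup i] ++ arc (k + 2)) := by
  obtain ⟨j, rfl⟩ := Nat.exists_eq_add_of_le hi
  induction j with
  | zero =>
    have h1 := (hD.cup_over_over (n := n + 2) (i := i + 1) (by omega)).symm.append_left
      (arc_isTangle (m := n) (k := i) hk)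
    have h2 := (hD.arc_far .cup (n := n) (m := n + 2) (k := i) (i := 0) hk rfl).append_right
      (v := [overCross (i + 1), overCross (i + 2)]) (k := n + 4)
      (by simp only [isTangle_cons_iff, isTangle_nil_iff, Piece.dom, Piece.cod]; omega)
    simpa [arc] using h1.trans (by simpa using h2)
  | succ j ih =>
    have h1 := (hD.slide (n := n + 2) (m := n + 4) (i := i + 1) (j := i + j + 1)
      (j' := i + j + 3) .cup (.node .overCross) (by simp only [Piece.dom]; omega) rfl
      (by simp only [Piece.dom]; omega) rfl).append_left (arc_isTangle (m := n) (k := i + j)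
        (by omega))
    have h2 := (ih (by omega) (by omega)).append_right (v := [overCross (i + j + 3)]) (k := n + 4)
      (by simp only [isTangle_cons_iff, isTangle_nil_iff, Piece.dom, Piece.cod]; omega)
    simpa [arc, ← add_assoc] using h1.trans (by simpa [arc, ← add_assoc] using h2)

theorem arc_cap {n k i : ℕ} (hi : i ≤ k) (hk : k ≤ n) :
    TangleEquiv D (n + 2) (n + 2) (arc (k + 2) ++ [cap (i + 1)]) ([cap i] ++ arc k) := by
  obtain ⟨j, rfl⟩ := Nat.exists_eq_add_of_le hi
  induction j with
  | zero =>
    have h1 := (hD.over_over_cap (n := n + 2) (i := i + 1) (by omega)).append_left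
      (arc_isTangle (m := n + 2) (k := i) (by omega))
    have h2 := hD.arc_far .cap (n := n + 2) (m := n) (k := i) (i := 0)
      (by simp only [Piece.dom]; omega) rfl
    simpa [arc] using h1.trans h2
  | succ j ih =>
    have h1 := (hD.slide (n := n + 4) (m := n + 2) (i := i + 1) (j := i + j + 3)
      (j' := i + j + 1) .cap (.node .overCross) (by simp only [Piece.dom]; omega) rfl
      (by simp only [Piece.dom]; omega) rfl).append_left (arc_isTangle (m := n + 2) (k := i + j + 2)
        (by omega))
    have h2 := (ih (by omega) (by omega)).append_right (v := [overCross (i + j + 1)]) (k := n + 2)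
      (by simp only [isTangle_cons_iff, isTangle_nil_iff, Piece.dom, Piece.cod]; omega)
    simpa [arc, ← add_assoc] using h1.trans (by simpa [arc, ← add_assoc] using h2)

/-- The third Reidemeister move takes the crossing past the two crossings of the arc with the same
strands; the other crossings of the arc are distant. -/
theorem arc_over {n k i : ℕ} (hi : i ≤ k) (hk : k + 2 ≤ n) :
    TangleEquiv D n (n + 2) (arc (k + 2) ++ [overCross (i + 1)]) ([overCross i] ++ arc (k + 2)) := by
  obtain ⟨j, rfl⟩ := Nat.exists_eq_add_of_le hi
  induction j with
  | zero =>
    have h1 := (hD.braid (n := n + 2) (i := i + 1) (by omega)).append_left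
      (arc_isTangle (m := n) (k := i) (by omega))
    have h2 := (hD.arc_far (.node .overCross) (n := n) (m := n) (k := i) (i := 0)
      (by simp only [Piece.dom]; omega) rfl).append_right
      (v := [overCross (i + 1), overCross (i + 2)]) (k := n + 2)
      (by simp only [isTangle_cons_iff, isTangle_nil_iff, Piece.dom, Piece.cod]; omega)
    simpa [arc] using h1.trans (by simpa using h2)
  | succ j ih =>
    have h1 := (hD.slide (n := n + 2) (m := n + 2) (i := i + 1) (j := i + j + 3)
      (j' := i + j + 3) (.node .overCross) (.node .overCross) (by simp only [Piece.dom]; omega) rfl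
      (by simp only [Piece.dom]; omega) rfl).append_left (arc_isTangle (m := n) (k := i + j + 2)
        (by omega))
    have h2 := (ih (by omega) (by omega)).append_right (v := [overCross (i + j + 3)]) (k := n + 2)
      (by simp only [isTangle_cons_iff, isTangle_nil_iff, Piece.dom, Piece.cod]; omega)
    simpa [arc, ← add_assoc] using h1.trans (by simpa [arc, ← add_assoc] using h2)

/-- The right foot is joined to its right neighbour. Turning the last crossing of the arc around
this maximum makes it a crossing that is distant from the rest of the arc and can be moved below it.
-/
theorem arc_leg_cap {n k : ℕ} (hk : k + 2 ≤ n) :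
    TangleEquiv D n n (arc (k + 1) ++ [cap (k + 2)]) ([underCross k] ++ (arc k ++ [cap (k + 1)])) := by
  have h1 := (hD.turn_cap (n := n) (i := k + 1) .underCross (by omega)).symm.append_left
    (arc_isTangle (m := n) (k := k) (by omega))
  have h2 := (hD.arc_far (.node .underCross) (n := n) (m := n) (k := k) (i := 0)
    (by simp only [Piece.dom]; omega) rfl).append_right (v := [cap (k + 1)]) (k := n)
    (by simp only [isTangle_cons_iff, isTangle_nil_iff, Piece.dom, Piece.cod]; omega)
  simpa [arc, Node.turn] using h1.trans (by simpa using h2)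

/-! #### Reduction to layered tangles -/

/-- The crossing-change relation is applied to the crossing of a curl: the two crossings give `a`
and `a⁻¹`, one smoothing gives a circle and the other a strand with two zigzags. A strand is needed
to carry the curl. -/
theorem closureValue_circle (hAB : A ≠ B) {n : ℕ} {w : List Slice} (hw : IsTangle 0 w n)
    (hn : 1 ≤ n) :
    closureValue D (w ++ [cup 0, cap 0]) =
      ((a - a⁻¹) / (A - B) + 1) • closureValue D w := by
  have hAB' : A - B ≠ 0 := sub_ne_zero.2 hAB
  have hw' : IsTangle 0 (w ++ [cup 0]) (n + 2) := hw.append (by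
    simp only [isTangle_cons_iff, isTangle_nil_iff, Piece.dom, Piece.cod]; omega)
  have h1 := congr_arg (stackMap K [cap 0])
    (hD.closureValue_over_sub_under (i := 1) hw' (by omega))
  simp only [map_add, map_smul, map_sub, stackMap_closureValue] at h1
  have h2 := hD.closureValue_curl_over (i := 0) hw hn
  have h3 := hD.closureValue_curl_under (i := 0) hw hn
  have h4 := ((hD.cup_cap (i := 0) hn).append_right (v := [cup 1, cap 0]) (k := n) (by
    simp only [isTangle_cons_iff, isTangle_nil_iff, Piece.dom, Piece.cod]; omega)).trans
      (hD.cup_cap' (i := 0) hn)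
  have h5 := h4.closureValue_eq hw
  simp only [List.append_assoc, List.cons_append, List.nil_append, List.append_nil, zero_add]
    at h1 h2 h3 h5
  rw [h2, h3, h5] at h1
  have h6 : (A - B) • closureValue D (w ++ [cup 0, cap 0]) =
      (a - a⁻¹ + (A - B)) • closureValue D w := by
    rw [smul_sub, ← sub_eq_iff_eq_add', ← sub_smul, eq_sub_iff_add_eq] at h1
    rw [← h1, add_smul]
  rw [← inv_smul_smul₀ hAB' (closureValue D (w ++ [cup 0, cap 0])), h6, smul_smul]
  congr 1
  field_simp

/-- No strand is available here. A nonempty closure starts with a minimum, which is moved below the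
circle to provide one; for the empty closure both sides vanish. -/
theorem closureValue_unknot (hAB : A ≠ B) :
    closureValue D [cup 0, cap 0] = ((a - a⁻¹) / (A - B) + 1) • closureValue D [] := by
  have hcirc : IsTangle 0 [cup 0, cap 0] 0 := by
    simp [isTangle_cons_iff, isTangle_nil_iff, Piece.dom, Piece.cod]
  have hcup : IsTangle 0 [cup 0] 2 := by
    simp [isTangle_cons_iff, isTangle_nil_iff, Piece.dom, Piece.cod]
  ext v
  by_cases hv : IsTangle 0 v 0
  swap
  · simp only [closureValue, Pi.smul_apply, smul_eq_mul]
    rw [hD.eq_zero _ (by rwa [hcirc.append_iff]), List.nil_append, hD.eq_zero _ hv, mul_zero]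
  rcases v with _ | ⟨⟨p, i⟩, v⟩
  · simp [closureValue, hD.nil, hD.unknot]
  have h := (isTangle_cons_iff.1 hv).1
  obtain ⟨rfl, rfl⟩ : i = 0 ∧ p = .cup := by
    cases p <;> simp_all [Piece.dom]
  have h1 := (hD.slide (n := 2) (m := 2) (i := 0) (j := 2) (j' := 0) .cap .cup le_rfl rfl
    (by simp [Piece.dom]) rfl).symm.append_left hcup
  have h2 := (hD.slide (n := 0) (m := 4) (i := 0) (j := 0) (j' := 2) .cup .cup le_rfl rfl
    le_rfl rfl).symm.append_right (v := [cap 0]) (k := 2) (by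
      simp [isTangle_cons_iff, isTangle_nil_iff, Piece.dom, Piece.cod])
  have h3 := congr_fun ((h1.trans h2).closureValue_eq (.nil 0)) v
  have h4 := congr_fun (hD.closureValue_circle hAB hcup (by omega)) v
  simp only [closureValue, List.cons_append, List.nil_append, Pi.smul_apply] at h3 h4 ⊢
  rw [h3, h4]

/-- Each use of `arc_leg_cap` shortens the arc, at the cost of a crossing below it that is absorbed
by `h`. In the end the arc and the maximum form a zigzag. -/
theorem layeredSpan_leg_cap {n : ℕ} (h : LayeredClosed D n) {k : ℕ} (hk : k + 1 ≤ 2 * n)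
    {w : List Slice} (hw : IsTangle 0 w (2 * n)) (hwD : closureValue D w ∈ layeredSpan D n) :
    closureValue D (w ++ (arc k ++ [cap (k + 1)])) ∈ layeredSpan D n := by
  induction k generalizing w with
  | zero =>
    change closureValue D (w ++ [cup 0, cap (0 + 1)]) ∈ _
    rw [(hD.cup_cap (i := 0) hk).closureValue_eq hw, List.append_nil]
    exact hwD
  | succ k ih =>
    rw [(hD.arc_leg_cap hk).closureValue_eq hw, ← List.append_assoc]
    refine ih (by omega) (hw.append ?_) (h.under_mem hk hwD)
    simp only [isTangle_cons_iff, isTangle_nil_iff, Piece.dom, Piece.cod]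
    omega

/-- The left foot is joined to its neighbour, which gives a circle for `k = 0` and a curl for `k =
1`. For longer arcs the last crossing is distant and moves above the maximum, where only `n` layers
remain. -/
theorem layeredSpan_cap_zero (hAB : A ≠ B) {n : ℕ} (h : LayeredClosed D n) {k : ℕ}
    (hk : k ≤ 2 * n) {w : List Slice} (hw : IsLayered n w) :
    closureValue D (w ++ (arc k ++ [cap 0])) ∈ layeredSpan D n := by
  induction k using Nat.twoStepInduction with
  | zero =>
    have : closureValue D (w ++ [cup 0, cap 0]) =
        ((a - a⁻¹) / (A - B) + 1) • closureValue D w := by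
      rcases hw with _ | ⟨hw, hk'⟩
      · exact hD.closureValue_unknot hAB
      · exact hD.closureValue_circle hAB (hw.arc hk').isTangle (by omega)
    exact this ▸ Submodule.smul_mem _ _ (hw.mem_layeredSpan D)
  | one =>
    exact hD.closureValue_curl_over hw.isTangle hk ▸
      Submodule.smul_mem _ _ (hw.mem_layeredSpan D)
  | more k _ ih =>
    have h1 := (hD.slide (n := 2 * n + 2) (m := 2 * n) (i := 0) (j := k + 2) (j' := k) .cap
      (.node .overCross) (by simp [Piece.dom]) rfl (by simp [Piece.dom]; omega) rfl).append_left
        (arc_isTangle (m := 2 * n) (k := k + 1) (by omega))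
    have h2 := h1.closureValue_eq hw.isTangle
    have h3 := h.over_mem hk (ih (by omega))
    have h4 : arc (k + 2) = arc (k + 1) ++ [overCross (k + 2)] := rfl
    rw [h4, List.append_assoc]
    simp only [List.append_assoc, List.cons_append, List.nil_append] at h2 h3 ⊢
    rwa [h2]

theorem layeredSpan_cap_succ {n : ℕ} (h : LayeredClosed D n) {i : ℕ} (hi : i + 1 ≤ 2 * n) {w : List Slice}
    (hw : IsLayered (n + 1) w) : closureValue D (w ++ [cap (i + 1)]) ∈ layeredSpan D n := by
  obtain _ | @⟨_, k, w, hw, hk⟩ := hw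
  rw [List.append_assoc]
  have hn : 2 ≤ 2 * n → n - 1 + 1 = n ∧ 2 * n - 2 + 2 = 2 * n := by omega
  -- The right foot is strand `k + 1`. The maximum lies between the feet, or joins the right foot to
  -- its left or right neighbour, or lies beyond it.
  rcases lt_trichotomy (i + 1) k with hik | rfl | hik
  · obtain ⟨k, rfl⟩ : ∃ l, k = l + 2 := ⟨k - 2, by omega⟩
    obtain ⟨hn1, hn2⟩ := hn (by omega)
    have h1 := hD.arc_cap (n := 2 * n - 2) (i := i) (k := k) (by omega) (by omega)
    rw [hn2] at h1
    rw [h1.closureValue_eq hw.isTangle, ← List.append_assoc, ← hn1]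
    exact layeredSpan_arc (by omega) (h.cap_mem (by omega) (hw.mem_layeredSpan D))
  · have h1 := hD.closureValue_over_cap (n := 2 * n) (i := i + 1)
      (hw.isTangle.append (arc_isTangle (k := i) (by omega))) (by omega)
    have h2 := hD.layeredSpan_leg_cap h (k := i) (by omega) hw.isTangle (hw.mem_layeredSpan D)
    simp only [arc, List.append_assoc, List.cons_append, List.nil_append] at h1 h2 ⊢
    exact h1 ▸ Submodule.smul_mem _ _ h2
  · by_cases hik' : i = k
    · subst hik'
      exact hD.layeredSpan_leg_cap h hi hw.isTangle (hw.mem_layeredSpan D)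
    · obtain ⟨j, rfl⟩ := Nat.exists_eq_add_of_le (show k + 1 ≤ i by omega)
      obtain ⟨hn1, hn2⟩ := hn (by omega)
      have h1 := hD.arc_far .cap (n := 2 * n) (m := 2 * n - 2) (k := k) (i := j)
        (by simp only [Piece.dom]; omega) (by simp only [Piece.dom, Piece.cod]; omega)
      rw [show k + 1 + j + 1 = k + 2 + j by omega, h1.closureValue_eq hw.isTangle,
        ← List.append_assoc, ← hn1]
      exact layeredSpan_arc (by omega) (h.cap_mem (by omega) (hw.mem_layeredSpan D))

theorem layeredSpan_cap (hAB : A ≠ B) {n : ℕ} (h : LayeredClosed D n) {i : ℕ}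
    (hi : i ≤ 2 * n) {w : List Slice} (hw : closureValue D w ∈ layeredSpan D (n + 1)) :
    closureValue D (w ++ [cap i]) ∈ layeredSpan D n := by
  refine layeredSpan_slice (fun w hw => ?_) hw
  cases i with
  | zero =>
    obtain _ | ⟨hw, hk⟩ := hw
    rw [List.append_assoc]
    exact hD.layeredSpan_cap_zero hAB h hk hw
  | succ i => exact hD.layeredSpan_cap_succ h hi hw

theorem layeredSpan_cup {n : ℕ} (h : LayeredClosed D n) {i : ℕ} (hi : i ≤ 2 * (n + 1))
    {w : List Slice} (hw : closureValue D w ∈ layeredSpan D (n + 1)) :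
    closureValue D (w ++ [cup i]) ∈ layeredSpan D (n + 2) := by
  cases i with
  | zero => exact layeredSpan_arc (Nat.zero_le _) hw
  | succ i =>
    refine layeredSpan_slice (fun w hw => ?_) hw
    obtain _ | @⟨_, k, w, hw, hk⟩ := hw
    rw [List.append_assoc]
    by_cases hik : i ≤ k
    · rw [(hD.arc_cup hik hk).closureValue_eq hw.isTangle, ← List.append_assoc]
      exact layeredSpan_arc (by omega) (h.cup_mem (by omega) (hw.mem_layeredSpan D))
    · obtain ⟨j, rfl⟩ := Nat.exists_eq_add_of_le (show k + 1 ≤ i by omega)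
      have h1 := hD.arc_far .cup (n := 2 * n) (m := 2 * n + 2) (k := k) (i := j)
        (by simp only [Piece.dom]; omega) rfl
      rw [show k + 1 + j + 1 = k + 2 + j by omega, h1.closureValue_eq hw.isTangle,
        ← List.append_assoc]
      exact layeredSpan_arc (by omega) (h.cup_mem (by omega) (hw.mem_layeredSpan D))

theorem layeredSpan_over_succ (hAB : A ≠ B) {n : ℕ} (h : LayeredClosed D n) {i : ℕ}
    (hi : i + 1 ≤ 2 * n) {w : List Slice} (hw : closureValue D w ∈ layeredSpan D (n + 1)) :
    closureValue D (w ++ [overCross (i + 1)]) ∈ layeredSpan D (n + 1) := by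
  refine layeredSpan_slice (fun w hw => ?_) hw
  obtain _ | @⟨_, k, w, hw, hk⟩ := hw
  rcases lt_trichotomy (i + 1) k with hik | rfl | hik
  · rw [List.append_assoc]
    obtain ⟨k, rfl⟩ : ∃ l, k = l + 2 := ⟨k - 2, by omega⟩
    rw [(hD.arc_over (i := i) (by omega) hk).closureValue_eq hw.isTangle, ← List.append_assoc]
    exact layeredSpan_arc hk (h.over_mem (by omega) (hw.mem_layeredSpan D))
  · have harc : IsTangle 0 (w ++ arc i) (2 * n + 2) :=
      hw.isTangle.append (arc_isTangle (by omega))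
    have h1 := (hw.arc hk).mem_layeredSpan D
    have h2 := (hw.arc (k := i) (by omega)).mem_layeredSpan D
    -- The right foot would cross the same strand twice. Once the new crossing is changed, it
    -- cancels with the last crossing of the arc; the smoothings are covered by the hypotheses.
    rw [hD.closureValue_over_sub_under (hw.arc hk).isTangle (by omega)]
    have h3 := (hD.over_under (n := 2 * n + 2) (i := i + 1) (by omega)).closureValue_eq harc
    have h4 := h.cup_mem (i := i + 1) (by omega)
      (hD.layeredSpan_cap hAB h (i := i + 1) (by omega) h1)
    simp only [arc, List.append_assoc, List.cons_append, List.nil_append, List.append_nil]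
      at h1 h2 h3 h4 ⊢
    rw [h3]
    exact Submodule.add_mem _ h2 (Submodule.smul_mem _ _ (Submodule.sub_mem _ h1 h4))
  · by_cases hik' : i = k
    · subst hik'
      rw [List.append_assoc]
      exact (hw.arc (k := i + 1) hi).mem_layeredSpan D
    · rw [List.append_assoc]
      obtain ⟨j, rfl⟩ := Nat.exists_eq_add_of_le (show k + 1 ≤ i by omega)
      have h1 := hD.arc_far (.node .overCross) (n := 2 * n) (m := 2 * n) (k := k) (i := j)
        (by simp only [Piece.dom]; omega) rfl
      rw [show k + 1 + j + 1 = k + 2 + j by omega, h1.closureValue_eq hw.isTangle,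
        ← List.append_assoc]
      exact layeredSpan_arc (by omega) (h.over_mem (by omega) (hw.mem_layeredSpan D))

/-- The crossing of the left foot with its neighbour is a curl for `k = 0` and cancels after a turn
for `k = 1`. Otherwise it commutes with the last crossing of the arc, which is then added again by
`layeredSpan_over_succ`. -/
theorem layeredSpan_over_zero (hAB : A ≠ B) {n : ℕ} (h : LayeredClosed D n) {w : List Slice}
    (hw : closureValue D w ∈ layeredSpan D (n + 1)) :
    closureValue D (w ++ [overCross 0]) ∈ layeredSpan D (n + 1) := by
  refine layeredSpan_slice (fun w hw => ?_) hw
  obtain _ | @⟨_, k, w, hw, hk⟩ := hw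
  rw [List.append_assoc]
  induction k using Nat.twoStepInduction with
  | zero =>
    exact hD.closureValue_cup_over hw.isTangle (Nat.zero_le _) ▸
      Submodule.smul_mem _ _ ((hw.arc (k := 0) (by omega)).mem_layeredSpan D)
  | one =>
    have h1 := (hD.turn_cup (n := 2 * n) (i := 0) .overCross hk).append_right (v := [overCross 0])
      (k := 2 * n + 2)
      (by simp only [isTangle_cons_iff, isTangle_nil_iff, Piece.dom, Piece.cod]; omega)
    have h2 := (hD.under_over (n := 2 * n + 2) (i := 0) (by omega)).append_left (u := [cup 1])
      (k := 2 * n)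
      (by simp only [isTangle_cons_iff, isTangle_nil_iff, Piece.dom, Piece.cod]; omega)
    exact (h1.trans h2).closureValue_eq hw.isTangle ▸ h.cup_mem hk (hw.mem_layeredSpan D)
  | more k _ ih =>
    have h1 := (hD.slide (n := 2 * n + 2) (m := 2 * n + 2) (i := 0) (j := k + 2) (j' := k + 2)
      (.node .overCross) (.node .overCross) (by simp [Piece.dom]) rfl
      (by simp only [Piece.dom]; omega) rfl).append_left
        (arc_isTangle (m := 2 * n) (k := k + 1) (by omega))
    have h2 := h1.closureValue_eq hw.isTangle
    have h3 := hD.layeredSpan_over_succ hAB h hk (ih (by omega))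
    have h4 : arc (k + 2) = arc (k + 1) ++ [overCross (k + 2)] := rfl
    rw [h4, List.append_assoc]
    simp only [List.append_assoc, List.cons_append, List.nil_append] at h2 h3 ⊢
    rwa [h2]

theorem layeredClosed (hAB : A ≠ B) (n : ℕ) : LayeredClosed D n := by
  induction n with
  | zero =>
    refine ⟨fun {i w} hi hw => ?_, fun hi _ => by omega, fun hi _ => by omega,
      fun hi _ => by omega⟩
    obtain rfl : i = 0 := by omega
    exact layeredSpan_arc (k := 0) le_rfl hw
  | succ n h =>
    have hover {i : ℕ} {w : List Slice} (hi : i + 2 ≤ 2 * (n + 1))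
        (hw : closureValue D w ∈ layeredSpan D (n + 1)) :
        closureValue D (w ++ [overCross i]) ∈ layeredSpan D (n + 1) := by
      cases i with
      | zero => exact hD.layeredSpan_over_zero hAB h hw
      | succ i => exact hD.layeredSpan_over_succ hAB h (by omega) hw
    refine ⟨fun hi hw => hD.layeredSpan_cup h hi hw, fun hi hw => hD.layeredSpan_cap hAB h (by omega) hw, hover,
      fun {i w} hi hw => layeredSpan_slice (fun w hw => ?_) hw⟩
    have h1 := hw.mem_layeredSpan D
    -- The other crossing is obtained by a crossing change.
    have h2 := hD.closureValue_over_sub_under hw.isTangle hi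
    have h3 := h.cup_mem (i := i) (by omega) (hD.layeredSpan_cap hAB h (i := i) (by omega) h1)
    rw [← sub_eq_iff_eq_add] at h2
    rw [List.append_assoc] at h3
    exact h2 ▸ Submodule.sub_mem _ (hover hi h1)
      (Submodule.smul_mem _ _ (Submodule.sub_mem _ h1 h3))

theorem exists_closureValue_mem (hAB : A ≠ B) {w : List Slice} {m : ℕ} (hw : IsTangle 0 w m) :
    ∃ n, m = 2 * n ∧ closureValue D w ∈ layeredSpan D n := by
  induction w using List.reverseRecOn generalizing m with
  | nil => exact ⟨0, (isTangle_nil_iff.1 hw).symm, IsLayered.nil.mem_layeredSpan D⟩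
  | append_singleton w s ih =>
    obtain ⟨k, h1, h2⟩ := isTangle_append_iff.1 hw
    obtain ⟨n, rfl, h3⟩ := ih h1
    have h := hD.layeredClosed hAB n
    obtain ⟨p, i⟩ := s
    simp only [isTangle_cons_iff, isTangle_nil_iff] at h2
    rcases p with _ | _ | x
    · simp only [Piece.dom, Piece.cod] at h2
      exact ⟨n + 1, by omega, h.cup_mem (by omega) h3⟩
    · simp only [Piece.dom, Piece.cod] at h2
      exact ⟨n - 1, by omega, h.cap_mem (by omega) h3⟩
    · simp only [Piece.dom, Piece.cod] at h2
      refine ⟨n, by omega, ?_⟩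
      rcases x with _ | _ | _
      · exact h.over_mem (by omega) h3
      · exact h.under_mem (by omega) h3
      -- The skein relation is solved for the vertex.
      · have h4 := hD.closureValue_over h1 (i := i) (by omega)
        have h5 := (hD.layeredClosed hAB (n - 1)).cup_mem (i := i) (by omega)
          (h.cap_mem (i := i) (by omega) h3)
        rw [List.append_assoc, Nat.sub_add_cancel (by omega)] at h5
        rw [← sub_eq_iff_eq_add'] at h4
        exact h4 ▸ Submodule.sub_mem _ (h.over_mem (by omega) h3)
          (Submodule.add_mem _ (Submodule.smul_mem _ _ h3) (Submodule.smul_mem _ _ h5))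

theorem eq_zero_of_ne (hAB : A ≠ B) (w : List Slice) : D w = 0 := by
  by_cases hw : IsTangle 0 w 0
  · obtain ⟨n, h0, hn⟩ := hD.exists_closureValue_mem hAB hw
    obtain rfl : n = 0 := by omega
    have h1 : layeredSpan D 0 ≤ LinearMap.ker (LinearMap.proj (R := K) (φ := fun _ => K) []) := by
      refine Submodule.span_le.2 ?_
      rintro _ ⟨u, hu, rfl⟩
      cases hu
      simp [closureValue, hD.nil]
    simpa [closureValue] using h1 hn
  · exact hD.eq_zero w hw

end IsSkeinFunctional
-- Differences of polynomials, uniqueness and specialisation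
open Classical in
/-- The difference of two functions of diagrams, extended by zero to all words. -/
noncomputable def wordDifference (P Q : GraphDiagram → K) (w : List Slice) : K :=
  if h : IsTangle 0 w 0 ∧ w ≠ [] then P ⟨w, h.1, h.2⟩ - Q ⟨w, h.1, h.2⟩ else 0

theorem wordDifference_of_isTangle (P Q : GraphDiagram → K) {w : List Slice}
    (h : IsTangle 0 w 0) (h' : w ≠ []) :
    wordDifference P Q w = P ⟨w, h, h'⟩ - Q ⟨w, h, h'⟩ :=
  dif_pos ⟨h, h'⟩

theorem wordDifference_of_not_isTangle (P Q : GraphDiagram → K) {w : List Slice}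
    (h : ¬ IsTangle 0 w 0) : wordDifference P Q w = 0 :=
  dif_neg fun h' => h h'.1

theorem Move.ne_nil {u s t v : List Slice} (h : Move s t) (hs : IsTangle 0 (u ++ s ++ v) 0) :
    u ++ s ++ v ≠ [] ∧ u ++ t ++ v ≠ [] := by
  refine ⟨fun h' => ?_, fun h' => ?_⟩
  · obtain ⟨rfl, rfl, rfl⟩ : u = [] ∧ s = [] ∧ v = [] := by simpa using h'
    cases h
  · obtain ⟨rfl, rfl, rfl⟩ : u = [] ∧ t = [] ∧ v = [] := by simpa using h'
    cases h <;> simp [isTangle_cons_iff, isTangle_nil_iff, Piece.dom, Piece.cod] at hs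

theorem isTangle_replace {u s t v : List Slice}
    (hst : ∀ n m, IsTangle n s m → IsTangle n t m) (h : IsTangle 0 (u ++ s ++ v) 0) :
    IsTangle 0 (u ++ t ++ v) 0 := by
  obtain ⟨m, h1, h2⟩ := isTangle_append_iff.1 h
  obtain ⟨n, h3, h4⟩ := isTangle_append_iff.1 h1
  exact (h3.append (hst n m h4)).append h2

theorem isSkeinFunctional_wordDifference {A B : K} {a : Kˣ} {P Q : GraphDiagram → K}
    (hP : IsKauffmanVogel A B a P) (hQ : IsKauffmanVogel A B a Q) :
    IsSkeinFunctional A B (a : K) (wordDifference P Q) := by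
  have node_tangles {x : Node} {u v : List Slice} {i : ℕ}
      (h : IsTangle 0 (u ++ [node x i] ++ v) 0) :
      (IsTangle 0 (u ++ v) 0 ∧ u ++ v ≠ []) ∧
      IsTangle 0 (u ++ [cap i, cup i] ++ v) 0 ∧ IsTangle 0 (u ++ [vertex i] ++ v) 0 := by
    refine ⟨⟨?_, fun h' => ?_⟩, ?_, ?_⟩
    · rw [← List.append_nil u]
      refine isTangle_replace (fun n m hs => ?_) h
      simp only [isTangle_cons_iff, isTangle_nil_iff, Piece.dom, Piece.cod] at hs ⊢
      omega
    · obtain ⟨rfl, rfl⟩ : u = [] ∧ v = [] := by simpa using h'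
      simp [isTangle_cons_iff, isTangle_nil_iff, Piece.dom, Piece.cod] at h
    all_goals
      refine isTangle_replace (fun n m hs => ?_) h
      simp only [isTangle_cons_iff, isTangle_nil_iff, Piece.dom, Piece.cod] at hs ⊢
      omega
  have curl_tangles {x : Node} {u v : List Slice} {i : ℕ}
      (h : IsTangle 0 (u ++ [cup i, node x (i + 1), cap i] ++ v) 0) :
      IsTangle 0 (u ++ v) 0 ∧ u ++ v ≠ [] := by
    refine ⟨?_, fun h' => ?_⟩
    · rw [← List.append_nil u]
      refine isTangle_replace (fun n m hs => ?_) h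
      simp only [isTangle_cons_iff, isTangle_nil_iff, Piece.dom, Piece.cod] at hs ⊢
      omega
    · obtain ⟨rfl, rfl⟩ : u = [] ∧ v = [] := by simpa using h'
      simp [isTangle_cons_iff, isTangle_nil_iff, Piece.dom, Piece.cod] at h
  constructor
  · exact fun w hw => wordDifference_of_not_isTangle P Q hw
  · exact dif_neg fun h => h.2 rfl
  · change wordDifference P Q unknot.word = 0
    rw [wordDifference_of_isTangle P Q unknot.closed unknot.nonempty]
    exact sub_eq_zero.2 (hP.unknot_eq_one.trans hQ.unknot_eq_one.symm)
  · intro u s t v hst hs ht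
    have h := hst.ne_nil hs
    rw [wordDifference_of_isTangle P Q hs h.1, wordDifference_of_isTangle P Q ht h.2,
      hP.regular_isotopy _ ⟨_, ht, h.2⟩ u v s t hst rfl rfl,
      hQ.regular_isotopy _ ⟨_, ht, h.2⟩ u v s t hst rfl rfl]
  · intro u v i h
    obtain ⟨h1, h2, h3⟩ := node_tangles h
    rw [wordDifference_of_isTangle P Q h (by simp), wordDifference_of_isTangle P Q h1.1 h1.2,
      wordDifference_of_isTangle P Q h2 (by simp), wordDifference_of_isTangle P Q h3 (by simp),
      hP.skein_over _ ⟨_, h1.1, h1.2⟩ ⟨_, h2, by simp⟩ ⟨_, h3, by simp⟩ u v i rfl rfl rfl rfl,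
      hQ.skein_over _ ⟨_, h1.1, h1.2⟩ ⟨_, h2, by simp⟩ ⟨_, h3, by simp⟩ u v i rfl rfl rfl rfl]
    ring
  · intro u v i h
    obtain ⟨h1, h2, h3⟩ := node_tangles h
    rw [wordDifference_of_isTangle P Q h (by simp), wordDifference_of_isTangle P Q h1.1 h1.2,
      wordDifference_of_isTangle P Q h2 (by simp), wordDifference_of_isTangle P Q h3 (by simp),
      hP.skein_under _ ⟨_, h1.1, h1.2⟩ ⟨_, h2, by simp⟩ ⟨_, h3, by simp⟩ u v i rfl rfl rfl rfl,
      hQ.skein_under _ ⟨_, h1.1, h1.2⟩ ⟨_, h2, by simp⟩ ⟨_, h3, by simp⟩ u v i rfl rfl rfl rfl]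
    ring
  · intro u v i h
    obtain ⟨h1, h1'⟩ := curl_tangles h
    rw [wordDifference_of_isTangle P Q h (by simp), wordDifference_of_isTangle P Q h1 h1',
      hP.curl_pos _ ⟨_, h1, h1'⟩ u v i (.inr rfl) rfl,
      hQ.curl_pos _ ⟨_, h1, h1'⟩ u v i (.inr rfl) rfl, mul_sub]
  · intro u v i h
    obtain ⟨h1, h1'⟩ := curl_tangles h
    rw [wordDifference_of_isTangle P Q h (by simp), wordDifference_of_isTangle P Q h1 h1',
      hP.curl_neg _ ⟨_, h1, h1'⟩ u v i (.inr rfl) rfl,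
      hQ.curl_neg _ ⟨_, h1, h1'⟩ u v i (.inr rfl) rfl, Units.val_inv_eq_inv_val, mul_sub]

/-- Over a field, there is at most one Kauffman--Vogel polynomial with given variables `A ≠ B`
and `a`. -/
theorem IsKauffmanVogel.unique {A B : K} {a : Kˣ} {P Q : GraphDiagram → K}
    (hP : IsKauffmanVogel A B a P) (hQ : IsKauffmanVogel A B a Q) (hAB : A ≠ B) : P = Q := by
  funext G
  rw [← sub_eq_zero]
  have h := (isSkeinFunctional_wordDifference hP hQ).eq_zero_of_ne hAB G.word
  rwa [wordDifference_of_isTangle P Q G.closed G.nonempty] at h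

theorem IsKauffmanVogel.map {R S : Type*} [CommRing R] [CommRing S] {A B : R} {a : Rˣ}
    {P : GraphDiagram → R} (hP : IsKauffmanVogel A B a P) (φ : R →+* S) :
    IsKauffmanVogel (φ A) (φ B) (Units.map φ a) fun G => φ (P G) where
  regular_isotopy G H u v s t h hG hH := by rw [hP.regular_isotopy G H u v s t h hG hH]
  skein_over X V H W u v i hX hV hH hW := by
    rw [hP.skein_over X V H W u v i hX hV hH hW]
    simp
  skein_under X V H W u v i hX hV hH hW := by
    rw [hP.skein_under X V H W u v i hX hV hH hW]
    simp
  curl_pos T S u v i hT hS := by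
    rw [hP.curl_pos T S u v i hT hS]
    simp
  curl_neg T S u v i hT hS := by
    rw [hP.curl_neg T S u v i hT hS, map_mul, ← map_inv]
    simp
  unknot_eq_one := by rw [hP.unknot_eq_one, map_one]

end Uniqueness
/-! ### Colourings and separating curves -/

/-- The colourings of the strands at the bottom of a word that extend to colourings which
contribute to the state sum. -/
inductive IsColorable : List Slice → List Bool → Prop
  | nil : IsColorable [] []
  | cup (x y : List Bool) (b : Bool) (w : List Slice) :
      IsColorable w (x ++ b :: b :: y) → IsColorable (cup x.length :: w) (x ++ y)
  | cap (x y : List Bool) (b : Bool) (w : List Slice) :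
      IsColorable w (x ++ y) → IsColorable (cap x.length :: w) (x ++ b :: b :: y)
  | vertex (x y : List Bool) (b : Bool) (w : List Slice) :
      IsColorable w (x ++ b :: b :: y) → IsColorable (vertex x.length :: w) (x ++ b :: b :: y)
  | crossing (c : Node) (hc : c ≠ .vertex) (x y : List Bool) (p q : Bool) (w : List Slice) :
      IsColorable w (x ++ (!q) :: (!p) :: y) →
      IsColorable (node c x.length :: w) (x ++ p :: q :: y)

/-- The parity of the number of separating curves among the strands. -/
def curveParity : List Strand → Bool
  | [] => false
  | .edge :: s => curveParity s
  | .curve :: s => !curveParity s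

/-- The colours of the edges among the strands: they change at each separating curve. -/
def edgeColors : Bool → List Strand → List Bool
  | _, [] => []
  | b, .edge :: s => b :: edgeColors b s
  | b, .curve :: s => edgeColors (!b) s

theorem edgeColors_append (b : Bool) (x y : List Strand) :
    edgeColors b (x ++ y) = edgeColors b x ++ edgeColors (b ^^ curveParity x) y := by
  induction x generalizing b with
  | nil => simp [edgeColors, curveParity]
  | cons s x ih => cases s <;> simp [edgeColors, curveParity, ih]

theorem curveParity_append (x y : List Strand) :
    curveParity (x ++ y) = (curveParity x ^^ curveParity y) := by
  induction x with
  | nil => simp [curveParity]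
  | cons s x ih => cases s <;> simp [curveParity, ih]

theorem count_edge (b : Bool) (x : List Strand) : x.count .edge = (edgeColors b x).length := by
  induction x generalizing b with
  | nil => rfl
  | cons s x ih => cases s <;> simp [edgeColors, ← ih]

open Strand in
-- Colours alternate across the curves. A curve passes each crossing so that the colours there
-- change as required, and no curve passes a vertex, so its ends agree in colour.
theorem IsSeparated.isColorable {s t : List Strand} {w : List Slice} {M : List Mark}
    (h : IsSeparated s w M t) (ht : t = []) (b : Bool) : IsColorable w (edgeColors b s) := by
  induction h with
  | nil s =>
    subst ht
    exact .nil
  | birth x y t w M h ih => simpa [edgeColors_append, edgeColors, curveParity_append, curveParity] using ih ht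
  | death x y t w M h ih => simpa [edgeColors_append, edgeColors, curveParity_append, curveParity] using ih ht
  | cup x y t w M h ih =>
    rw [edgeColors_append, count_edge b]
    refine .cup _ _ (b ^^ curveParity x) _ ?_
    simpa [edgeColors_append, edgeColors, curveParity_append, curveParity] using ih ht
  | cap x y t w M h ih =>
    have := IsColorable.cap (edgeColors b x) (edgeColors (b ^^ curveParity x) y) (b ^^ curveParity x) w
      (by simpa [edgeColors_append, edgeColors, curveParity_append, curveParity] using ih ht)
    simpa [edgeColors_append, edgeColors, curveParity_append, curveParity, count_edge b] using this
  | vertex x y t w M h ih =>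
    have := IsColorable.vertex (edgeColors b x) (edgeColors (b ^^ curveParity x) y)
      (b ^^ curveParity x) w
      (by simpa [edgeColors_append, edgeColors, curveParity_append, curveParity] using ih ht)
    simpa [edgeColors_append, edgeColors, curveParity_append, curveParity, count_edge b] using this
  | vertical c hc x y t w M h ih =>
    have := IsColorable.crossing c hc (edgeColors b x) (edgeColors (!(b ^^ curveParity x)) y)
      (b ^^ curveParity x) (!(b ^^ curveParity x)) w
      (by simpa [edgeColors_append, edgeColors, curveParity_append, curveParity] using ih ht)
    simpa [edgeColors_append, edgeColors, curveParity_append, curveParity, count_edge b] using this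
  | horizontal c hc x y t w M h ih =>
    have := IsColorable.crossing c hc (edgeColors b x) (edgeColors (b ^^ curveParity x) y)
      (b ^^ curveParity x) (b ^^ curveParity x) w
      (by simpa [edgeColors_append, edgeColors, curveParity_append, curveParity] using ih ht)
    simpa [edgeColors_append, edgeColors, curveParity_append, curveParity, count_edge b] using this

theorem exists_of_edgeColors_eq_append {b : Bool} {s : List Strand} {x y : List Bool}
    (h : edgeColors b s = x ++ y) :
    ∃ x' y', s = x' ++ y' ∧ edgeColors b x' = x ∧ edgeColors (b ^^ curveParity x') y' = y := by
  induction s generalizing b x with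
  | nil =>
    obtain ⟨rfl, rfl⟩ : x = [] ∧ y = [] := by simpa [edgeColors] using h.symm
    exact ⟨[], [], rfl, rfl, rfl⟩
  | cons a s ih =>
    cases a with
    | edge =>
      rcases x with _ | ⟨c, x⟩
      · exact ⟨[], _, rfl, rfl, by simpa [curveParity] using h⟩
      · simp only [edgeColors, List.cons_append, List.cons.injEq] at h
        obtain ⟨rfl, h⟩ := h
        obtain ⟨x', y', rfl, h1, h2⟩ := ih h
        exact ⟨.edge :: x', y', rfl, by simp [edgeColors, h1], by simpa [curveParity] using h2⟩
    | curve =>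
      obtain ⟨x', y', rfl, h1, h2⟩ := ih (b := !b) h
      exact ⟨.curve :: x', y', rfl, by simpa [edgeColors] using h1, by simpa [curveParity] using h2⟩

/-- Curves to the left of an edge can be joined in pairs, until at most one is left. -/
theorem exists_of_edgeColors_eq_cons {b c : Bool} {s : List Strand} {y : List Bool}
    (h : edgeColors b s = c :: y) :
    ∃ y', edgeColors c y' = y ∧ curveParity s = (b ^^ c ^^ curveParity y') ∧
      ∀ (z t : List Strand) (w : List Slice) (M : List Mark),
      IsSeparated (z ++ (if b = c then [] else [.curve]) ++ .edge :: y') w M t →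
      IsSeparated (z ++ s) w M t := by
  induction s generalizing b with
  | nil => simp [edgeColors] at h
  | cons a s ih =>
    cases a with
    | edge =>
      simp only [edgeColors, List.cons.injEq] at h
      obtain ⟨rfl, h⟩ := h
      exact ⟨s, h, by simp [curveParity], fun z t w M h => by simpa using h⟩
    | curve =>
      obtain ⟨y', h1, h2, h3⟩ := ih (b := !b) h
      refine ⟨y', h1, by simp [curveParity, h2], fun z t w M h => ?_⟩
      have h4 := h3 (z ++ [.curve]) t w M
      rw [List.append_assoc z [.curve] s] at h4
      refine h4 ?_
      cases b <;> cases c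
      -- The new curve and the one left by the induction are adjacent and are joined by a maximum.
      · simpa using IsSeparated.death z (.edge :: y') t w M (by simpa using h)
      · simpa using h
      · simpa using h
      · simpa using IsSeparated.death z (.edge :: y') t w M (by simpa using h)

theorem isSeparated_nil_of_edgeColors_eq_nil {b : Bool} {s : List Strand}
    (h : edgeColors b s = []) (hs : curveParity s = false) : IsSeparated s [] [] [] := by
  match s with
  | [] => exact .nil []
  | [.curve] => simp [curveParity] at hs
  | .edge :: _ => simp [edgeColors] at h
  | .curve :: .edge :: _ => simp [edgeColors] at h
  | .curve :: .curve :: s =>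
    refine IsSeparated.death [] s [] [] [] (isSeparated_nil_of_edgeColors_eq_nil (b := b) ?_ ?_)
    · simpa [edgeColors] using h
    · simpa [curveParity] using hs

/-- Before two neighbouring edges can enter a piece, the curves between them have to be joined in
pairs. One curve is left exactly when the colours of the edges differ. -/
theorem exists_of_edgeColors_eq_append_two {b p q : Bool} {s : List Strand} {x y : List Bool}
    (h : edgeColors b s = x ++ p :: q :: y) :
    ∃ x' y', edgeColors b x' = x ∧ (b ^^ curveParity x') = p ∧ edgeColors q y' = y ∧
      curveParity s = (b ^^ q ^^ curveParity y') ∧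
      ∀ (t : List Strand) (w : List Slice) (M : List Mark),
      IsSeparated (x' ++ [.edge] ++ (if p = q then [] else [.curve]) ++ .edge :: y') w M t →
      IsSeparated s w M t := by
  obtain ⟨x', y', rfl, h1, h2⟩ := exists_of_edgeColors_eq_append h
  obtain ⟨s', h3, h4, h5⟩ := exists_of_edgeColors_eq_cons h2
  obtain ⟨y'', h6, h7, h8⟩ := exists_of_edgeColors_eq_cons h3
  by_cases hp : (b ^^ curveParity x') = p
  · refine ⟨x', y'', h1, hp, h6, ?_, fun t w M h => ?_⟩
    · rw [curveParity_append, h4, h7, ← hp]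
      cases b <;> cases curveParity x' <;> simp
    · refine h5 x' t w M ?_
      simp only [hp, if_true, List.append_nil]
      have h9 := h8 (x' ++ [.edge]) t w M h
      rwa [List.append_assoc] at h9
  -- A single curve is left before the first of the two edges; it is counted with the strands on the
  -- left.
  · refine ⟨x' ++ [.curve], y'', by simp [edgeColors_append, edgeColors, h1], ?_, h6, ?_,
      fun t w M h => ?_⟩
    · simp only [curveParity_append, curveParity]
      revert hp
      cases b <;> cases curveParity x' <;> cases p <;> simp
    · rw [curveParity_append, h4, h7]
      cases b <;> cases curveParity x' <;> cases p <;> simp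
    · refine h5 x' t w M ?_
      simp only [hp, if_false]
      have h9 := h8 (x' ++ [.curve] ++ [.edge]) t w M h
      rwa [List.append_assoc (x' ++ [Strand.curve])] at h9

/-- The curves are drawn upwards along the colouring, so that the colour always records the parity
of the curves to the left. Their total number stays even, which allows the remaining ones to be
joined at the top. -/
theorem IsColorable.exists_isSeparated {w : List Slice} {c : List Bool} (h : IsColorable w c)
    {b : Bool} {s : List Strand} (hc : edgeColors b s = c) (hs : curveParity s = false) :
    ∃ M, IsSeparated s w M [] := by
  induction h generalizing s with
  | nil => exact ⟨[], isSeparated_nil_of_edgeColors_eq_nil hc hs⟩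
  | cup x y d w h ih =>
    obtain ⟨x', y', rfl, rfl, rfl⟩ := exists_of_edgeColors_eq_append hc
    by_cases hd : (b ^^ curveParity x') = d
    · obtain ⟨M, hM⟩ := ih (s := x' ++ [.edge, .edge] ++ y')
        (by simp [edgeColors_append, edgeColors, hd])
        (by simpa [curveParity_append, curveParity] using hs)
      exact ⟨M, count_edge b x' ▸ .cup x' y' [] w M hM⟩
    -- The minimum has the wrong colour for its region, so it is enclosed by the two ends of a newly
    -- born curve.
    · have hd' : d = !(b ^^ curveParity x') := by
        revert hd
        cases (b ^^ curveParity x') <;> cases d <;> simp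
      obtain ⟨M, hM⟩ := ih (s := x' ++ [.curve] ++ [.edge, .edge] ++ .curve :: y')
        (by simp [edgeColors_append, edgeColors, hd'])
        (by simpa [curveParity_append, curveParity] using hs)
      refine ⟨M, .birth x' y' [] _ M ?_⟩
      have := IsSeparated.cup (x' ++ [.curve]) (.curve :: y') [] w M hM
      simpa [count_edge b, edgeColors_append, edgeColors] using this
  | cap x y d w h ih =>
    obtain ⟨x', y', rfl, h1, rfl, h2, h3⟩ := exists_of_edgeColors_eq_append_two hc
    obtain ⟨M, hM⟩ := ih (s := x' ++ y') (by simp [edgeColors_append, h1])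
      (by rw [← hs, h2, curveParity_append, ← h1]; cases b <;> simp)
    refine ⟨M, h3 _ _ _ ?_⟩
    have := IsSeparated.cap x' y' [] w M hM
    simpa [count_edge b] using this
  | vertex x y d w h ih =>
    obtain ⟨x', y', rfl, h1, rfl, h2, h3⟩ := exists_of_edgeColors_eq_append_two hc
    obtain ⟨M, hM⟩ := ih (s := x' ++ [.edge, .edge] ++ y')
      (by simp [edgeColors_append, edgeColors, h1])
      (by rw [← hs, h2]; simp only [curveParity_append, curveParity, ← h1]; cases b <;> simp)
    refine ⟨M, h3 _ _ _ ?_⟩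
    have := IsSeparated.vertex x' y' [] w M hM
    simpa [count_edge b] using this
  | crossing c hc' x y p q w h ih =>
    obtain ⟨x', y', rfl, h1, rfl, h2, h3⟩ := exists_of_edgeColors_eq_append_two hc
    by_cases hpq : p = q
    · subst hpq
      obtain ⟨M, hM⟩ := ih (s := x' ++ [.curve, .edge, .edge, .curve] ++ y')
        (by simp [edgeColors_append, edgeColors, h1])
        (by rw [← hs, h2]; simp only [curveParity_append, curveParity, ← h1]; cases b <;> simp)
      refine ⟨.horizontal :: M, h3 _ _ _ ?_⟩
      have := IsSeparated.horizontal c hc' x' y' [] w M hM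
      simpa [count_edge b] using this
    · obtain rfl : q = !p := by
        revert hpq
        cases p <;> cases q <;> simp
      obtain ⟨M, hM⟩ := ih (s := x' ++ [.edge, .curve, .edge] ++ y')
        (by simp [edgeColors_append, edgeColors, h1])
        (by rw [← hs, h2]; simp only [curveParity_append, curveParity, ← h1]; cases b <;> simp)
      refine ⟨.vertical :: M, h3 _ _ _ ?_⟩
      have := IsSeparated.vertical c hc' x' y' [] w M hM
      simpa [count_edge b] using this

theorem GraphDiagram.separable_iff_isColorable (G : GraphDiagram) :
    G.Separable ↔ IsColorable G.word [] :=
  ⟨fun ⟨_, hM⟩ => IsSeparated.isColorable hM rfl false,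
    fun h => h.exists_isSeparated (b := false) (s := []) rfl rfl⟩

/-! ### Non-vanishing of the state sum -/

/-- The quotients of polynomials with positive values at `1`. -/
def IsPositive (r : RatFunc ℚ) : Prop :=
  ∃ p q : Polynomial ℚ, 0 < p.eval 1 ∧ 0 < q.eval 1 ∧
    r = algebraMap _ (RatFunc ℚ) p / algebraMap _ (RatFunc ℚ) q

theorem algebraMap_ne_zero_of_eval_pos {p : Polynomial ℚ} (h : 0 < p.eval 1) :
    algebraMap _ (RatFunc ℚ) p ≠ 0 := by
  rw [Ne, FaithfulSMul.algebraMap_eq_zero_iff]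
  rintro rfl
  simp at h

theorem IsPositive.ne_zero {r : RatFunc ℚ} (h : IsPositive r) : r ≠ 0 := by
  obtain ⟨p, q, hp, hq, rfl⟩ := h
  exact div_ne_zero (algebraMap_ne_zero_of_eval_pos hp) (algebraMap_ne_zero_of_eval_pos hq)

theorem IsPositive.add {r s : RatFunc ℚ} (hr : IsPositive r) (hs : IsPositive s) :
    IsPositive (r + s) := by
  obtain ⟨p, q, hp, hq, rfl⟩ := hr
  obtain ⟨p', q', hp', hq', rfl⟩ := hs
  refine ⟨p * q' + q * p', q * q', ?_, ?_, ?_⟩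
  · simp only [Polynomial.eval_add, Polynomial.eval_mul]
    positivity
  · simp only [Polynomial.eval_mul]
    positivity
  · rw [div_add_div _ _ (algebraMap_ne_zero_of_eval_pos hq) (algebraMap_ne_zero_of_eval_pos hq')]
    simp only [map_add, map_mul]

theorem IsPositive.mul {r s : RatFunc ℚ} (hr : IsPositive r) (hs : IsPositive s) :
    IsPositive (r * s) := by
  obtain ⟨p, q, hp, hq, rfl⟩ := hr
  obtain ⟨p', q', hp', hq', rfl⟩ := hs
  refine ⟨p * p', q * q', ?_, ?_, ?_⟩
  · simp only [Polynomial.eval_mul]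
    positivity
  · simp only [Polynomial.eval_mul]
    positivity
  · rw [div_mul_div_comm]
    simp only [map_mul]

theorem IsPositive.inv {r : RatFunc ℚ} (hr : IsPositive r) : IsPositive r⁻¹ := by
  obtain ⟨p, q, hp, hq, rfl⟩ := hr
  exact ⟨q, p, hq, hp, inv_div _ _⟩

theorem isPositive_one : IsPositive 1 := ⟨1, 1, by simp, by simp, by simp⟩

theorem isPositive_X : IsPositive RatFunc.X := ⟨Polynomial.X, 1, by simp, by simp, by simp⟩

/-! ### Inversion of colourings at each kind of slice -/

section Inversion

variable {i : ℕ} {x y : List Bool} {w : List Slice} {p q : Bool}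

theorem isColorable_cup_iff (hx : x.length = i) :
    IsColorable (cup i :: w) (x ++ y) ↔ ∃ b, IsColorable w (x ++ b :: b :: y) := by
  subst hx
  constructor
  · intro h
    generalize hs : cup x.length :: w = l, hc : x ++ y = c at h
    cases h <;> simp at hs
    obtain ⟨hl, rfl⟩ := hs
    obtain ⟨rfl, rfl⟩ := List.append_inj hc hl
    exact ⟨_, ‹_›⟩
  · rintro ⟨b, h⟩
    exact .cup x y b w h

theorem isColorable_cap_iff (hx : x.length = i) :
    IsColorable (cap i :: w) (x ++ p :: q :: y) ↔ p = q ∧ IsColorable w (x ++ y) := by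
  subst hx
  constructor
  · intro h
    generalize hs : cap x.length :: w = l, hc : x ++ p :: q :: y = c at h
    cases h <;> simp at hs
    obtain ⟨hl, rfl⟩ := hs
    obtain ⟨rfl, h⟩ := List.append_inj hc hl
    obtain ⟨rfl, rfl, rfl⟩ : p = _ ∧ q = _ ∧ y = _ := by simpa using h
    exact ⟨rfl, ‹_›⟩
  · rintro ⟨rfl, h⟩
    exact .cap x y p w h

theorem isColorable_vertex_iff (hx : x.length = i) :
    IsColorable (vertex i :: w) (x ++ p :: q :: y) ↔
      p = q ∧ IsColorable w (x ++ p :: q :: y) := by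
  subst hx
  constructor
  · intro h
    generalize hs : vertex x.length :: w = l, hc : x ++ p :: q :: y = c at h
    cases h <;> simp at hs
    · obtain ⟨hl, rfl⟩ := hs
      obtain ⟨rfl, h⟩ := List.append_inj hc hl
      obtain ⟨rfl, rfl, rfl⟩ : p = _ ∧ q = _ ∧ y = _ := by simpa using h
      exact ⟨rfl, ‹_›⟩
    · exact absurd hs.1.1.symm ‹_›
  · rintro ⟨rfl, h⟩
    exact .vertex x y p w h

theorem isColorable_crossing_iff {c : Node} (hc : c ≠ .vertex) (hx : x.length = i) :
    IsColorable (node c i :: w) (x ++ p :: q :: y) ↔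
      IsColorable w (x ++ (!q) :: (!p) :: y) := by
  subst hx
  constructor
  · intro h
    generalize hs : node c x.length :: w = l, hd : x ++ p :: q :: y = d at h
    cases h <;> simp at hs
    · exact absurd hs.1.1 hc
    · obtain ⟨⟨rfl, hl⟩, rfl⟩ := hs
      obtain ⟨rfl, h⟩ := List.append_inj hd hl
      obtain ⟨rfl, rfl, rfl⟩ : p = _ ∧ q = _ ∧ y = _ := by simpa using h
      exact ‹_›
  · exact .crossing c hc x y p q w

end Inversion

/-- `r` is positive if `b` holds, and zero otherwise. -/
def IsPositiveIff (r : RatFunc ℚ) (b : Prop) : Prop := (b ∧ IsPositive r) ∨ (¬ b ∧ r = 0)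

theorem IsPositiveIff.eq_zero_iff {r : RatFunc ℚ} {b : Prop} (h : IsPositiveIff r b) :
    r = 0 ↔ ¬ b := by
  rcases h with ⟨hb, h⟩ | ⟨hb, h⟩
  · simp [hb, h.ne_zero]
  · simp [hb, h]

theorem IsPositiveIff.add {r s : RatFunc ℚ} {b c : Prop} (hr : IsPositiveIff r b)
    (hs : IsPositiveIff s c) : IsPositiveIff (r + s) (b ∨ c) := by
  rcases hr with ⟨hb, hr⟩ | ⟨hb, rfl⟩ <;> rcases hs with ⟨hc, hs⟩ | ⟨hc, rfl⟩
  · exact .inl ⟨.inl hb, hr.add hs⟩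
  · exact .inl ⟨.inl hb, by simpa using hr⟩
  · exact .inl ⟨.inr hc, by simpa using hs⟩
  · exact .inr ⟨by tauto, by simp⟩

theorem IsPositiveIff.mul {r s : RatFunc ℚ} {b : Prop} (hs : IsPositiveIff s b)
    (hr : IsPositive r) : IsPositiveIff (r * s) b := by
  rcases hs with ⟨hc, hs⟩ | ⟨hc, rfl⟩
  · exact .inl ⟨hc, hr.mul hs⟩
  · exact .inr ⟨hc, mul_zero r⟩

/-- The factor `e` is a sign given by the parity of the number of vertices. The point is that it
does not depend on `c`: the two terms at a minimum are then positive or zero simultaneously with the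
same `e`, and cannot cancel. -/
theorem isPositiveIff_stateSum {w : List Slice} {n : ℕ} (hw : IsTangle n w 0) :
    ∃ e : RatFunc ℚ, e ≠ 0 ∧ ∀ c : List Bool, c.length = n →
      IsPositiveIff (e * stateSum RatFunc.X w c) (IsColorable w c) := by
  induction w generalizing n with
  | nil =>
    obtain rfl := isTangle_nil_iff.1 hw
    refine ⟨1, one_ne_zero, fun c hc => ?_⟩
    obtain rfl := List.length_eq_zero_iff.1 hc
    exact .inl ⟨.nil, by simpa [stateSum, wordOp] using isPositive_one⟩
  | cons s w ih =>
    obtain ⟨p, i⟩ := s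
    obtain ⟨hi, hw⟩ := isTangle_cons_iff.1 hw
    obtain ⟨e, he, ih⟩ := ih hw
    have hstep (c : List Bool) : stateSum (RatFunc.X : RatFunc ℚ) (⟨p, i⟩ :: w) c =
        sliceOp RatFunc.X ⟨p, i⟩ (stateSum RatFunc.X w) c := rfl
    rcases p with _ | _ | x
    · simp only [Piece.dom, Piece.cod] at hi ih
      refine ⟨e, he, fun c hc => ?_⟩
      obtain ⟨x, y, rfl, hx⟩ := exists_append_of_le_length (i := i) (c := c) (by omega)
      simp only [List.length_append] at hc
      rw [hstep, sliceOp_cup _ _ hx, isColorable_cup_iff hx, Bool.exists_bool, mul_add]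
      exact (ih _ (by simp; omega)).add (ih _ (by simp; omega))
    · simp only [Piece.dom, Piece.cod] at hi ih
      refine ⟨e, he, fun c hc => ?_⟩
      obtain ⟨x, p, q, y, rfl, hx⟩ := exists_append_two (i := i) (c := c) (by omega)
      simp only [List.length_append, List.length_cons] at hc
      rw [hstep, sliceOp_cap _ _ hx, isColorable_cap_iff hx]
      by_cases hpq : p = q
      · simpa [hpq] using ih (x ++ y) (by simp; omega)
      · exact .inr ⟨by simp [hpq], by simp [hpq]⟩
    · simp only [Piece.dom, Piece.cod] at hi ih
      have hcross (hx : x ≠ .vertex) : ∃ e : RatFunc ℚ, e ≠ 0 ∧ ∀ c : List Bool, c.length = n →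
          IsPositiveIff (e * stateSum RatFunc.X (node x i :: w) c)
            (IsColorable (node x i :: w) c) := by
        refine ⟨e, he, fun c hc => ?_⟩
        obtain ⟨z, p, q, y, rfl, hz⟩ := exists_append_two (i := i) (c := c) (by omega)
        simp only [List.length_append, List.length_cons] at hc
        rw [hstep, isColorable_crossing_iff hx hz]
        have h := ih (z ++ (!q) :: (!p) :: y) (by simp; omega)
        rcases x with _ | _ | _
        · rw [sliceOp_overCross _ _ hz, mul_left_comm]
          split_ifs
          · exact h.mul isPositive_X.inv
          · exact h.mul isPositive_X
        · rw [sliceOp_underCross _ _ hz, mul_left_comm]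
          split_ifs
          · exact h.mul isPositive_X
          · exact h.mul isPositive_X.inv
        · exact absurd rfl hx
      by_cases hx : x = .vertex
      · subst hx
        -- The new sign compensates for that of the vertex weight `-(A + A⁻¹)`.
        refine ⟨-e, neg_ne_zero.2 he, fun c hc => ?_⟩
        obtain ⟨z, p, q, y, rfl, hz⟩ := exists_append_two (i := i) (c := c) (by omega)
        have h := ih (z ++ p :: q :: y) (by rw [hc]; omega)
        rw [hstep, sliceOp_vertex _ _ hz, isColorable_vertex_iff hz]
        by_cases hpq : p = q
        · have h1 := h.mul (isPositive_X.add isPositive_X.inv)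
          simp only [hpq, true_and, if_true] at h1 ⊢
          convert h1 using 1
          ring
        · exact .inr ⟨by simp [hpq], by simp [hpq]⟩
      · exact hcross hx

theorem statePolynomial_eq_zero_iff (G : GraphDiagram) :
    statePolynomial (RatFunc.X : RatFunc ℚ) G = 0 ↔ ¬ G.Separable := by
  obtain ⟨e, he, h⟩ := isPositiveIff_stateSum G.closed
  rw [G.separable_iff_isColorable, ← (h [] rfl).eq_zero_iff]
  simp [statePolynomial, he]

theorem X_ne_inv_X : (RatFunc.X : RatFunc ℚ) ≠ RatFunc.X⁻¹ := by
  intro h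
  have h1 : (RatFunc.X : RatFunc ℚ) * RatFunc.X = 1 := by
    nth_rewrite 2 [h]
    exact mul_inv_cancel₀ RatFunc.X_ne_zero
  rw [← RatFunc.algebraMap_X, ← map_mul, ← map_one (algebraMap (Polynomial ℚ) (RatFunc ℚ))] at h1
  have h2 := congr_arg (Polynomial.eval 2) (RatFunc.algebraMap_injective ℚ h1)
  norm_num at h2

end KauffmanVogel

/-- At `B = A⁻¹`, `a = A`, with `A = X` an indeterminate, there is exactly one Kauffman--Vogel
polynomial; and whenever the Kauffman--Vogel polynomial `Q` in any variables `A`, `B`, `a` is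
specialised to these values (for instance, when it already has these values and `φ` is the
identity), the result vanishes exactly on the diagrams that are not separable. -/
theorem proposition4 :
    (∃! P : KauffmanVogel.GraphDiagram → RatFunc ℚ,
      KauffmanVogel.IsKauffmanVogel RatFunc.X RatFunc.X⁻¹
        (Units.mk0 RatFunc.X RatFunc.X_ne_zero) P) ∧
    ∀ {S : Type*} [CommRing S] (A B : S) (a : Sˣ) (Q : KauffmanVogel.GraphDiagram → S)
      (φ : S →+* RatFunc ℚ), KauffmanVogel.IsKauffmanVogel A B a Q →
      φ A = RatFunc.X → φ B = RatFunc.X⁻¹ → φ a = RatFunc.X →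
      ∀ G : KauffmanVogel.GraphDiagram, φ (Q G) = 0 ↔ ¬ G.Separable := by
  have hP := KauffmanVogel.statePolynomial_isKauffmanVogel (RatFunc.X_ne_zero (K := ℚ))
  refine ⟨⟨_, hP, fun Q hQ => hQ.unique hP KauffmanVogel.X_ne_inv_X⟩, ?_⟩
  intro S _ A B a Q φ hQ hA hB ha G
  -- The image satisfies the same relations with values in a field, so it is the state sum by
  -- uniqueness; nothing about `S` matters.
  have h := hQ.map φ
  have ha' : Units.map (φ : S →* RatFunc ℚ) a = Units.mk0 RatFunc.X RatFunc.X_ne_zero :=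
    Units.ext ha
  rw [hA, hB, ha'] at h
  rw [congr_fun (h.unique hP KauffmanVogel.X_ne_inv_X) G]
  exact KauffmanVogel.statePolynomial_eq_zero_iff G
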